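/- There are universal constants $C_1,C_2,C_3,C_4>0$ such that the following holds. Let $\xi^{(1)},\dots,\xi^{(m)}$ be independent copies of a random vector $\xi=(\xi_1,\dots,\xi_n)\in\mathbb{C}^n$ whose entries are i.i.d. with $\mathbb{E}[\xi_1]=0$, $\mathbb{E}[|\xi_1|^2]=1$, and subgaussian with parameter $K$, i.e. $\inf\{t>0:\mathbb{E}[\exp(|\xi_1|^2/t^2)]\le 2\}\le K<\infty$. Assume $|\mathbb{E}[\xi_1^2]|^2\le 1-\beta$ for some $\beta\in(0,1)$ and $$m\ \ge\ C_1\,\frac{K^{20}}{\beta^{5/2}}\,n .$$ For a signal $x_0\in\mathbb{C}^n$ and a noise vector $w\in\mathbb{R}^m$ put $y_i=|\langle \xi^{(i)},x_0\rangle|^2+w_i$ for $1\le i\le m$, and consider the program $$\text{minimize}\quad \sum_{i=1}^m\bigl|\operatorname{Tr}\bigl(\xi^{(i)}(\xi^{(i)})^*X\bigr)-y_i\bigr|\qquad\text{subject to } X\in\mathbb{C}^{n\times n}\text{ Hermitian positive semidefinite.}\tag{P}$$ Let $\|\cdot\|$ and $\|\cdot\|_\infty$ be the Euclidean and the maximum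 norm on $\mathbb{C}^n$, $\|w\|_{\ell_1}=\sum_i|w_i|$, and let $\|Z\|_1$ be the Schatten-1 norm of a Hermitian matrix $Z$ (the sum of the absolute values of its eigenvalues). Set $p_\beta=1-C_4\exp\bigl(-m\beta^4/(C_2K^{16})\bigr)$. Then: 1. With probability at least $p_\beta$, simultaneously for all $x_0\in\mathbb{C}^n\setminus\{0\}$ with $\|x_0\|_\infty\le\frac{1}{81}\|x_0\|$ and all $w\in\mathbb{R}^m$, every solution $\hat X$ of (P) satisfies $$\|\hat X-x_0x_0^*\|_1\ \le\ C_3\,\frac{K^8}{m\,\beta^{5/2}}\,\|w\|_{\ell_1}.$$ 2. If in addition $\mathbb{E}[|\xi_1|^4]\ge 1+\beta$, then with probability at least $p_\beta$ the same bound holds simultaneously for all $x_0\in\mathbb{C}^n\setminus\{0\}$, all $w\in\mathbb{R}^m$ and every solution $\hat X$ of (P). -/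

import Mathlib

open MeasureTheory ProbabilityTheory
open scoped ComplexOrder

noncomputable section

namespace PhaseLift

/-- The real vector space of Hermitian complex `n × n` matrices. -/
abbrev Herm (n : ℕ) : Type := selfAdjoint (Matrix (Fin n) (Fin n) ℂ)

theorem Herm.isHermitian {n : ℕ} (Z : Herm n) : (Z : Matrix (Fin n) (Fin n) ℂ).IsHermitian :=
  Z.2

/-- The cone of positive semidefinite Hermitian matrices. -/
def psdCone (n : ℕ) : Set (Herm n) :=
  {Z | (Z : Matrix (Fin n) (Fin n) ℂ).PosSemidef}

/-- The Schatten-1 norm of a Hermitian matrix: the sum of the absolute values of its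
eigenvalues, counted with multiplicity. -/
def schattenOne {n : ℕ} (Z : Herm n) : ℝ :=
  ∑ i, |Z.isHermitian.eigenvalues i|

/-- The Hilbert-Schmidt inner product `Tr (A* B)` of Hermitian matrices (a real number). -/
def hsInner {n : ℕ} (A B : Herm n) : ℝ :=
  (Matrix.trace ((A : Matrix (Fin n) (Fin n) ℂ).conjTranspose *
    (B : Matrix (Fin n) (Fin n) ℂ))).re

/-- The rank-one Hermitian matrix `x x*`. -/
def rankOne {n : ℕ} (x : EuclideanSpace ℂ (Fin n)) : Herm n :=
  ⟨Matrix.vecMulVec x.ofLp (star x.ofLp), by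
    rw [selfAdjoint.mem_iff, Matrix.star_eq_conjTranspose, Matrix.conjTranspose_vecMulVec,
      star_star]⟩

/-- The measurement operator `Z ↦ (⟨v i (v i)*, Z⟩)ᵢ` of the measurement vectors `v i`. -/
def measOp {n m : ℕ} (v : Fin m → EuclideanSpace ℂ (Fin n)) (Z : Herm n) : Fin m → ℝ :=
  fun i => hsInner (rankOne (v i)) Z

/-- The noisy phaseless observations `y i = |⟨v i, x₀⟩|² + w i`. -/
def observation {n m : ℕ} (v : Fin m → EuclideanSpace ℂ (Fin n))
    (x₀ : EuclideanSpace ℂ (Fin n)) (w : Fin m → ℝ) : Fin m → ℝ :=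
  fun i => ‖inner ℂ (v i) x₀‖ ^ 2 + w i

/-- The `ℓ₁` norm on `ℝᵐ`. -/
def l1Norm {m : ℕ} (w : Fin m → ℝ) : ℝ :=
  ∑ i, |w i|

/-- `X` solves the program: minimize `‖𝒜(X) - y‖_{ℓ₁}` over positive semidefinite `X`. -/
def IsSolution {n m : ℕ} (v : Fin m → EuclideanSpace ℂ (Fin n)) (y : Fin m → ℝ)
    (X : Herm n) : Prop :=
  X ∈ psdCone n ∧ IsMinOn (fun Y : Herm n => l1Norm (measOp v Y - y)) (psdCone n) X

/-- The nonzero signals `x` with `‖x‖_∞ ≤ μ ‖x‖`; the norm of `x.ofLp` is the sup norm. -/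
def boundedPeakSignals (n : ℕ) (μ : ℝ) : Set (EuclideanSpace ℂ (Fin n)) :=
  {x | x ≠ 0 ∧ ‖x.ofLp‖ ≤ μ * ‖x‖}

/-- The `ψ₂` norm `inf {t > 0 : E exp (|X|² / t²) ≤ 2}`, equal to `∞` if there is no such `t`. -/
def psiTwoNorm {Ω : Type*} [MeasurableSpace Ω] (P : Measure Ω) (X : Ω → ℂ) : ENNReal :=
  ⨅ (t : ℝ) (_ : 0 < t ∧
    ∫⁻ ω, ENNReal.ofReal (Real.exp (‖X ω‖ ^ 2 / t ^ 2)) ∂P ≤ 2), ENNReal.ofReal t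

/-- `X` is subgaussian with parameter `K`. -/
def IsSubgaussian {Ω : Type*} [MeasurableSpace Ω] (P : Measure Ω) (X : Ω → ℂ) (K : ℝ) : Prop :=
  psiTwoNorm P X ≤ ENNReal.ofReal K

/-- The vectors `ξ 0, …, ξ (m - 1)` are independent copies of a random vector in `ℂⁿ` with
i.i.d. `K`-subgaussian entries of mean zero and variance one. -/
structure IsSubgaussianEnsemble {Ω : Type*} [MeasurableSpace Ω] (P : Measure Ω) {n m : ℕ}
    (ξ : Fin m → Ω → EuclideanSpace ℂ (Fin n)) (K : ℝ) : Prop where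
  measurable : ∀ i, Measurable (ξ i)
  indep_vectors : iIndepFun ξ P
  indep_entries : ∀ i, iIndepFun (fun (j : Fin n) (ω : Ω) => ξ i ω j) P
  identDistrib : ∀ i i' j j', IdentDistrib (fun ω => ξ i ω j) (fun ω => ξ i' ω j') P P
  mean_zero : ∀ i j, ∫ ω, ξ i ω j ∂P = 0
  variance_one : ∀ i j, ∫ ω, ‖ξ i ω j‖ ^ 2 ∂P = 1
  subgaussian : ∀ i j, IsSubgaussian P (fun ω => ξ i ω j) K

/-- For the given measurement vectors, every solution `X` of the program recovers every signal
`x₀ ∈ S` under every noise vector `w` up to the Schatten-1 error `c ‖w‖_{ℓ₁}`. -/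
def UniformRecovery {n m : ℕ} (v : Fin m → EuclideanSpace ℂ (Fin n))
    (S : Set (EuclideanSpace ℂ (Fin n))) (c : ℝ) : Prop :=
  ∀ x₀ ∈ S, ∀ (w : Fin m → ℝ) (X : Herm n),
    IsSolution v (observation v x₀ w) X → schattenOne (X - rankOne x₀) ≤ c * l1Norm w

end PhaseLift

end

/-!
The proof rests on a lower bound for the measurements which is uniform over all error matrices:
with high probability every `Z = X - x₀ x₀*` with `X` positive semidefinite satisfies
`∑ |⟨ξᵢ ξᵢ*, Z⟩| ≥ m δ ‖Z‖₁`, where `δ` is of order `β ^ (5/4) / K ^ 3`. A solution of the program has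
an objective value not exceeding that of the signal, so its error obeys
`∑ |⟨ξᵢ ξᵢ*, Z⟩| ≤ 2 ‖w‖`, and recovery follows (`schattenOne_le_of_isSolution`).

*Geometry of the error.* As `Z` is nonnegative on the orthogonal complement of the unit vector `x`
in the direction of `x₀`, its Schatten-1 norm is at most `|Tr Z| + 4 ‖Z x‖`
(`schattenOne_le_abs_realTrace_add`). If the entries of `x` are small, then the diagonal of `Z`
contributes little to `Z x`, so `‖Z‖₁` is controlled by the trace and the off-diagonal part. The
second moment of `⟨ξ ξ*, Z⟩` is at least
`(Tr Z)² + (E|ξ₁|⁴ - 1) ∑ |Z_jj|² + (1 - |E ξ₁²|²) ∑_{j ≠ k} |Z_jk|²`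
(`le_integral_hsInner_rankOne_sq`), hence in both parts of the theorem at least `β ‖Z‖₁² / 20`.

*From second to first moments.* Since `⟨ξ ξ*, Z⟩ = ∑ λₖ |⟨vₖ, ξ⟩|²` in terms of the eigenvalues and
eigenvectors of `Z`, the variable `|⟨ξ ξ*, Z⟩| / ‖Z‖₁` is subexponential at scale `K ^ 2`. Comparing
the first, second and sixth moments gives `E |⟨ξ ξ*, Z⟩| ≥ 2 δ ‖Z‖₁` (`le_integral_abs_hsInner`).
The sixth moment is what makes the sampling condition `m ≥ C n K ^ 20 / β ^ (5/2)` sufficient: one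
needs `m δ²` to dominate `n K ^ 4`, and `δ²` is of order `β ^ (5/2) / K ^ 6`.

*Uniformity.* The deviation of the averages of `|⟨ξ ξ*, Z⟩|` below their means is controlled, for all
`Z` with `‖Z‖₁ = 1` at once, through the exponential moment of its supremum. Symmetrization and
contraction are performed one observation at a time (`lintegral_expSup_sub_abs_le`) and tensorize
(`lintegral_pi_expSup_le`). They leave `sup_Z ⟨∑ εᵢ ξᵢ ξᵢ*, Z⟩`, which by duality is at most the
maximum of the Hermitian form `∑ εᵢ |⟨v, ξᵢ⟩|²` over the sphere, and hence over a net with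
exponentially many points in `n` (`exists_abs_signedForm_le`). For each point of the net the signed
sum has independent subexponential terms, so its exponential moments factor. Only countably many
`Z` are needed, by continuity in the eigenvalues and eigenvectors.
-/

namespace PhaseLift

/-! ### Hermitian quadratic forms and the Schatten-1 norm -/

section Deterministic

variable {n : ℕ}

/-- The linear operator of a Hermitian matrix on `ℂⁿ`. -/
noncomputable abbrev Herm.toLin (Z : Herm n) :
    EuclideanSpace ℂ (Fin n) →ₗ[ℂ] EuclideanSpace ℂ (Fin n) :=
  Matrix.toEuclideanLin (Z : Matrix (Fin n) (Fin n) ℂ)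

/-- The trace of a Hermitian matrix, as a real number. -/
noncomputable def realTrace (Z : Herm n) : ℝ := ∑ j, ((Z : Matrix (Fin n) (Fin n) ℂ) j j).re

/-- The squared Frobenius norm of the diagonal part. -/
noncomputable def diagEnergy (Z : Herm n) : ℝ :=
  ∑ j, ‖(Z : Matrix (Fin n) (Fin n) ℂ) j j‖ ^ 2

/-- The squared Frobenius norm of the off-diagonal part. -/
noncomputable def offDiagEnergy (Z : Herm n) : ℝ :=
  ∑ j, ∑ k, if j = k then 0 else ‖(Z : Matrix (Fin n) (Fin n) ℂ) j k‖ ^ 2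

theorem Herm.toLin_apply (Z : Herm n) (x : EuclideanSpace ℂ (Fin n)) (j : Fin n) :
    Z.toLin x j = ∑ k, (Z : Matrix (Fin n) (Fin n) ℂ) j k * x k := rfl

theorem Herm.toLin_symm (Z : Herm n) (x y : EuclideanSpace ℂ (Fin n)) :
    inner ℂ (Z.toLin x) y = inner ℂ x (Z.toLin y) :=
  (Matrix.isSymmetric_toEuclideanLin_iff.2 Z.isHermitian) x y

theorem inner_toLin_eq_sum (Z : Herm n) (x : EuclideanSpace ℂ (Fin n)) :
    inner ℂ x (Z.toLin x) =
      ∑ j, ∑ k, (Z : Matrix (Fin n) (Fin n) ℂ) j k * (starRingEnd ℂ (x j) * x k) := by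
  simp only [PiLp.inner_apply, RCLike.inner_apply, Herm.toLin_apply, Finset.sum_mul]
  exact Finset.sum_congr rfl fun j _ => Finset.sum_congr rfl fun k _ => by ring

theorem hsInner_rankOne (Z : Herm n) (x : EuclideanSpace ℂ (Fin n)) :
    hsInner (rankOne x) Z = (inner ℂ x (Z.toLin x)).re := by
  rw [inner_toLin_eq_sum, hsInner, ← selfAdjoint.mem_iff.1 (rankOne x).2]
  congr 1
  simp only [Matrix.trace, Matrix.diag, Matrix.mul_apply, Matrix.star_eq_conjTranspose,
    Matrix.conjTranspose_conjTranspose, rankOne, Matrix.vecMulVec_apply, Pi.star_apply]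
  rw [Finset.sum_comm]
  exact Finset.sum_congr rfl fun j _ => Finset.sum_congr rfl fun k _ => by
    rw [starRingEnd_apply]; ring

theorem inner_toLin_eq_ofReal (Z : Herm n) (x : EuclideanSpace ℂ (Fin n)) :
    inner ℂ x (Z.toLin x) = (hsInner (rankOne x) Z : ℂ) := by
  rw [hsInner_rankOne]
  refine (Complex.conj_eq_iff_re.1 ?_).symm
  rw [inner_conj_symm, Z.toLin_symm]

theorem hsInner_rankOne_eq_sum_eigenvalues (Z : Herm n) (x : EuclideanSpace ℂ (Fin n)) :
    hsInner (rankOne x) Z =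
      ∑ k, Z.isHermitian.eigenvalues k *
        ‖inner ℂ (Z.isHermitian.eigenvectorBasis k) x‖ ^ 2 := by
  rw [← Complex.ofReal_inj, ← inner_toLin_eq_ofReal,
    ← Z.isHermitian.eigenvectorBasis.sum_inner_mul_inner, Complex.ofReal_sum]
  refine Finset.sum_congr rfl fun k _ => ?_
  have h : Z.toLin (Z.isHermitian.eigenvectorBasis k) =
      (Z.isHermitian.eigenvalues k : ℂ) • Z.isHermitian.eigenvectorBasis k := by
    ext j
    exact congrFun (Z.isHermitian.mulVec_eigenvectorBasis k) j
  rw [← Z.toLin_symm, h, inner_smul_left, Complex.conj_ofReal, ← inner_conj_symm]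
  push_cast
  rw [← Complex.conj_mul']
  ring

theorem hsInner_rankOne_rankOne (x y : EuclideanSpace ℂ (Fin n)) :
    hsInner (rankOne x) (rankOne y) = ‖inner ℂ x y‖ ^ 2 := by
  have h : (rankOne y).toLin x = inner ℂ y x • y := by
    ext j
    simp only [Herm.toLin_apply, rankOne, Matrix.vecMulVec_apply, Pi.star_apply, PiLp.smul_apply,
      PiLp.inner_apply, RCLike.inner_apply, smul_eq_mul, Finset.sum_mul, starRingEnd_apply]
    exact Finset.sum_congr rfl fun k _ => by ring
  rw [hsInner_rankOne, h, inner_smul_right, ← inner_conj_symm, Complex.conj_mul',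
    ← Complex.ofReal_pow, Complex.ofReal_re]

theorem hsInner_sub (A B C : Herm n) : hsInner A (B - C) = hsInner A B - hsInner A C := by
  simp [hsInner, Matrix.mul_sub]

theorem hsInner_rankOne_nonneg {X : Herm n} (hX : X ∈ psdCone n) (x : EuclideanSpace ℂ (Fin n)) :
    0 ≤ hsInner (rankOne x) X := by
  have h : (X : Matrix (Fin n) (Fin n) ℂ).PosSemidef := hX
  rw [hsInner_rankOne_eq_sum_eigenvalues]
  exact Finset.sum_nonneg fun k _ => mul_nonneg (h.eigenvalues_nonneg k) (sq_nonneg _)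

theorem realTrace_eq_sum_eigenvalues (Z : Herm n) :
    realTrace Z = ∑ k, Z.isHermitian.eigenvalues k := by
  have h := congrArg Complex.re Z.isHermitian.trace_eq_sum_eigenvalues
  simpa [Matrix.trace, realTrace] using h

theorem schattenOne_nonneg (Z : Herm n) : 0 ≤ schattenOne Z :=
  Finset.sum_nonneg fun _ _ => abs_nonneg _

theorem diagEnergy_le_schattenOne_sq (Z : Herm n) : diagEnergy Z ≤ schattenOne Z ^ 2 := by
  set v := Z.isHermitian.eigenvectorBasis
  have hdiag : ∀ j, ‖(Z : Matrix (Fin n) (Fin n) ℂ) j j‖ ≤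
      ∑ k, |Z.isHermitian.eigenvalues k| * ‖v k j‖ ^ 2 := by
    intro j
    have h1 := inner_toLin_eq_ofReal Z (EuclideanSpace.single j 1)
    rw [hsInner_rankOne_eq_sum_eigenvalues] at h1
    have h2 : inner ℂ (EuclideanSpace.single j (1 : ℂ)) (Z.toLin (EuclideanSpace.single j 1)) =
        (Z : Matrix (Fin n) (Fin n) ℂ) j j := by
      simp [EuclideanSpace.inner_single_left, Herm.toLin_apply]
    rw [← h2, h1, Complex.norm_real, Real.norm_eq_abs]
    refine (Finset.abs_sum_le_sum_abs _ _).trans (Finset.sum_le_sum fun k _ => ?_)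
    rw [abs_mul, abs_pow, abs_norm]
    simp [EuclideanSpace.inner_single_right, v]
  have hsum : ∑ j, ‖(Z : Matrix (Fin n) (Fin n) ℂ) j j‖ ≤ schattenOne Z := by
    refine (Finset.sum_le_sum fun j _ => hdiag j).trans ?_
    rw [Finset.sum_comm]
    refine Finset.sum_le_sum fun k _ => ?_
    rw [← Finset.mul_sum, ← EuclideanSpace.norm_sq_eq, v.orthonormal.1 k]
    simp
  refine le_trans ?_ (pow_le_pow_left₀ (Finset.sum_nonneg fun _ _ => norm_nonneg _) hsum 2)
  exact Finset.sum_sq_le_sq_sum_of_nonneg fun _ _ => norm_nonneg _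

/-- If `Z + s x x*` is positive semidefinite for some `s`, then `Z` is nonnegative on `x^⊥`, so that
its negative part is controlled by its action on `x`. -/
theorem schattenOne_le_abs_realTrace_add (Z : Herm n) (x : EuclideanSpace ℂ (Fin n))
    (hx : ‖x‖ = 1) (hpos : ∀ u, inner ℂ x u = 0 → 0 ≤ hsInner (rankOne u) Z) :
    schattenOne Z ≤ |realTrace Z| + 4 * ‖Z.toLin x‖ := by
  set v := Z.isHermitian.eigenvectorBasis with hv
  set a := hsInner (rankOne x) Z with ha
  have hxx : inner ℂ x x = (1 : ℂ) := by rw [inner_self_eq_norm_sq_to_K, hx]; simp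
  have heig : ∀ k, hsInner (rankOne (v k)) Z = Z.isHermitian.eigenvalues k := by
    intro k
    rw [hsInner_rankOne_eq_sum_eigenvalues, Finset.sum_eq_single k]
    · rw [← hv, inner_self_eq_norm_sq_to_K, v.orthonormal.1 k]; simp
    · intro l _ hl
      rw [← hv, v.orthonormal.2 hl]; simp
    · simp
  have hproj : ∀ k, hsInner (rankOne (v k - inner ℂ x (v k) • x)) Z =
      Z.isHermitian.eigenvalues k
        - 2 * (inner ℂ (Z.toLin x) (v k) * inner ℂ (v k) x).re + a * ‖inner ℂ (v k) x‖ ^ 2 := by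
    intro k
    rw [hsInner_rankOne, map_sub, map_smul, inner_sub_left, inner_sub_right, inner_sub_right,
      inner_smul_left, inner_smul_right, inner_smul_left, inner_smul_right,
      inner_toLin_eq_ofReal, inner_toLin_eq_ofReal, heig, ← ha, ← Z.toLin_symm x (v k),
      ← Z.toLin_symm (v k) x, ← inner_conj_symm x (v k), ← inner_conj_symm (Z.toLin (v k)) x,
      Z.toLin_symm x, ← Z.toLin_symm x (v k)]
    have h1 : (starRingEnd ℂ) ((starRingEnd ℂ) (inner ℂ (v k) x)) *
        ((starRingEnd ℂ) (inner ℂ (v k) x) * (a : ℂ)) = ((a * ‖inner ℂ (v k) x‖ ^ 2 : ℝ) : ℂ) := by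
      rw [Complex.conj_conj, ← mul_assoc, Complex.mul_conj']; push_cast; ring
    rw [h1]
    simp only [Complex.sub_re, Complex.mul_re, Complex.ofReal_re, Complex.conj_re, Complex.conj_im,
      Complex.conj_conj]
    ring
  have hterm : ∀ k, |Z.isHermitian.eigenvalues k| ≤
      (Z.isHermitian.eigenvalues k
        - 2 * (inner ℂ (Z.toLin x) (v k) * inner ℂ (v k) x).re + a * ‖inner ℂ (v k) x‖ ^ 2)
      + 2 * (‖inner ℂ (v k) (Z.toLin x)‖ * ‖inner ℂ (v k) x‖) + |a| * ‖inner ℂ (v k) x‖ ^ 2 := by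
    intro k
    have h0 : 0 ≤ hsInner (rankOne (v k - inner ℂ x (v k) • x)) Z := by
      apply hpos
      rw [inner_sub_right, inner_smul_right, hxx]; ring
    rw [hproj k] at h0
    have h1 : |(inner ℂ (Z.toLin x) (v k) * inner ℂ (v k) x).re| ≤
        ‖inner ℂ (v k) (Z.toLin x)‖ * ‖inner ℂ (v k) x‖ := by
      refine (Complex.abs_re_le_norm _).trans ?_
      rw [norm_mul, norm_inner_symm]
    have h2 : |a * ‖inner ℂ (v k) x‖ ^ 2| = |a| * ‖inner ℂ (v k) x‖ ^ 2 := by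
      rw [abs_mul, abs_of_nonneg (sq_nonneg ‖inner ℂ (v k) x‖)]
    have h3 := abs_le.1 h1
    have h4 := abs_le.1 h2.le
    rw [abs_le]
    constructor <;> linarith [h3.1, h3.2, h4.1, h4.2]
  have hcs : ∑ k, ‖inner ℂ (v k) (Z.toLin x)‖ * ‖inner ℂ (v k) x‖ ≤ ‖Z.toLin x‖ := by
    have h := Real.sum_mul_le_sqrt_mul_sqrt Finset.univ
      (fun k => ‖inner ℂ (v k) (Z.toLin x)‖) (fun k => ‖inner ℂ (v k) x‖)
    rw [v.sum_sq_norm_inner_right, v.sum_sq_norm_inner_right, hx] at h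
    simpa using h
  have hcross : ∑ k, (inner ℂ (Z.toLin x) (v k) * inner ℂ (v k) x).re = a := by
    rw [← Complex.re_sum, v.sum_inner_mul_inner, Z.toLin_symm, ← hsInner_rankOne]
  have hpars : ∑ k, ‖inner ℂ (v k) x‖ ^ 2 = 1 := by
    rw [v.sum_sq_norm_inner_right, hx]; simp
  have habs : |a| ≤ ‖Z.toLin x‖ := by
    rw [ha, hsInner_rankOne]
    refine (Complex.abs_re_le_norm _).trans ((norm_inner_le_norm _ _).trans ?_)
    rw [hx, one_mul]
  have hsum := Finset.sum_le_sum fun k (_ : k ∈ Finset.univ) => hterm k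
  simp only [Finset.sum_add_distrib, Finset.sum_sub_distrib, ← Finset.mul_sum] at hsum
  rw [hcross, hpars, ← realTrace_eq_sum_eigenvalues] at hsum
  have := le_abs_self (realTrace Z)
  have := neg_abs_le a
  unfold schattenOne
  linarith

theorem norm_sum_mul_sq_le (A : Fin n → Fin n → ℂ) (x : EuclideanSpace ℂ (Fin n)) :
    ∑ j, ‖∑ k, A j k * x k‖ ^ 2 ≤ (∑ j, ∑ k, ‖A j k‖ ^ 2) * ‖x‖ ^ 2 := by
  rw [Finset.sum_mul]
  refine Finset.sum_le_sum fun j _ => ?_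
  rw [EuclideanSpace.norm_sq_eq]
  refine le_trans (pow_le_pow_left₀ (norm_nonneg _) (norm_sum_le _ _) 2) ?_
  simp only [norm_mul]
  exact Finset.sum_mul_sq_le_sq_mul_sq _ _ _

theorem offDiagEnergy_nonneg (Z : Herm n) : 0 ≤ offDiagEnergy Z :=
  Finset.sum_nonneg fun _ _ => Finset.sum_nonneg fun _ _ => by split_ifs <;> positivity

theorem diagEnergy_nonneg (Z : Herm n) : 0 ≤ diagEnergy Z :=
  Finset.sum_nonneg fun _ _ => by positivity

theorem sum_norm_sq_eq_diagEnergy_add (Z : Herm n) :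
    ∑ j, ∑ k, ‖(Z : Matrix (Fin n) (Fin n) ℂ) j k‖ ^ 2 = diagEnergy Z + offDiagEnergy Z := by
  rw [diagEnergy, offDiagEnergy, ← Finset.sum_add_distrib]
  refine Finset.sum_congr rfl fun j _ => ?_
  rw [← Finset.sum_erase_add _ _ (Finset.mem_univ j), add_comm]
  congr 1
  rw [← Finset.sum_erase_add _ _ (Finset.mem_univ j), if_pos rfl, add_zero]
  exact Finset.sum_congr rfl fun k hk => by rw [if_neg (Finset.ne_of_mem_erase hk).symm]

theorem norm_toLin_le (Z : Herm n) (x : EuclideanSpace ℂ (Fin n)) (hx : ‖x‖ = 1) :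
    ‖Z.toLin x‖ ≤ √(diagEnergy Z + offDiagEnergy Z) := by
  apply Real.le_sqrt_of_sq_le
  have h := norm_sum_mul_sq_le (Z : Matrix (Fin n) (Fin n) ℂ) x
  rw [sum_norm_sq_eq_diagEnergy_add, hx] at h
  rw [EuclideanSpace.norm_sq_eq]
  simpa [Herm.toLin_apply] using h

/-- On a vector with small entries the diagonal part of a matrix acts weakly. -/
theorem norm_toLin_le_of_norm_apply_le (Z : Herm n) (x : EuclideanSpace ℂ (Fin n)) (hx : ‖x‖ = 1)
    {μ : ℝ} (hμ : 0 ≤ μ) (hpeak : ∀ j, ‖x j‖ ≤ μ) :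
    ‖Z.toLin x‖ ≤ μ * √(diagEnergy Z) + √(offDiagEnergy Z) := by
  set M := (Z : Matrix (Fin n) (Fin n) ℂ)
  let d : EuclideanSpace ℂ (Fin n) := WithLp.toLp 2 fun j => M j j * x j
  let o : EuclideanSpace ℂ (Fin n) :=
    WithLp.toLp 2 fun j => ∑ k, (if j = k then 0 else M j k) * x k
  have hsplit : Z.toLin x = d + o := by
    ext j
    simp only [Herm.toLin_apply, d, o, PiLp.add_apply]
    rw [← Finset.sum_erase_add _ _ (Finset.mem_univ j),
      ← Finset.sum_erase_add (Finset.univ) (fun k => (if j = k then 0 else M j k) * x k)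
        (Finset.mem_univ j), if_pos rfl, zero_mul, add_zero, add_comm]
    congr 1
    exact Finset.sum_congr rfl fun k hk => by rw [if_neg (Finset.ne_of_mem_erase hk).symm]
  have hd : ‖d‖ ≤ μ * √(diagEnergy Z) := by
    refine le_of_sq_le_sq ?_ (by positivity)
    rw [mul_pow, Real.sq_sqrt (diagEnergy_nonneg Z), EuclideanSpace.norm_sq_eq, diagEnergy,
      Finset.mul_sum]
    refine Finset.sum_le_sum fun j _ => ?_
    simp only [d, norm_mul, mul_pow]
    rw [mul_comm]
    gcongr
    exact hpeak j
  have ho : ‖o‖ ≤ √(offDiagEnergy Z) := by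
    apply Real.le_sqrt_of_sq_le
    have h := norm_sum_mul_sq_le (fun j k => if j = k then 0 else M j k) x
    rw [hx, one_pow, mul_one] at h
    rw [EuclideanSpace.norm_sq_eq]
    refine h.trans (le_of_eq ?_)
    exact Finset.sum_congr rfl fun j _ => Finset.sum_congr rfl fun k _ => by split_ifs <;> simp [M]
  rw [hsplit]
  exact (norm_add_le _ _).trans (add_le_add hd ho)

theorem schattenOne_sub_rankOne_le {X : Herm n} (hX : X ∈ psdCone n)
    {x₀ : EuclideanSpace ℂ (Fin n)} (h0 : x₀ ≠ 0) :
    schattenOne (X - rankOne x₀) ≤ |realTrace (X - rankOne x₀)| +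
      4 * ‖(X - rankOne x₀).toLin ((‖x₀‖⁻¹ : ℂ) • x₀)‖ := by
  have hn : ‖x₀‖ ≠ 0 := norm_ne_zero_iff.2 h0
  apply schattenOne_le_abs_realTrace_add
  · rw [norm_smul, norm_inv, Complex.norm_real, norm_norm, inv_mul_cancel₀ hn]
  · intro u hu
    have hu' : inner ℂ u x₀ = 0 := by
      rw [inner_smul_left, mul_eq_zero] at hu
      rw [inner_eq_zero_symm]
      refine hu.resolve_left ?_
      simpa using h0
    rw [hsInner_sub, hsInner_rankOne_rankOne, hu']
    simpa using hsInner_rankOne_nonneg hX u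

theorem schattenOne_sq_le_of_ne_zero {X : Herm n} (hX : X ∈ psdCone n)
    {x₀ : EuclideanSpace ℂ (Fin n)} (h0 : x₀ ≠ 0) :
    schattenOne (X - rankOne x₀) ^ 2 ≤ 20 * (realTrace (X - rankOne x₀) ^ 2 +
      (diagEnergy (X - rankOne x₀) + offDiagEnergy (X - rankOne x₀))) := by
  have hn : ‖x₀‖ ≠ 0 := norm_ne_zero_iff.2 h0
  set Z := X - rankOne x₀ with hZ
  have h1 := schattenOne_sub_rankOne_le hX h0
  have h2 := norm_toLin_le Z ((‖x₀‖⁻¹ : ℂ) • x₀)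
    (by rw [norm_smul, norm_inv, Complex.norm_real, norm_norm, inv_mul_cancel₀ hn])
  rw [← hZ] at h1
  have h3 := Real.sq_sqrt (add_nonneg (diagEnergy_nonneg Z) (offDiagEnergy_nonneg Z))
  set r := √(diagEnergy Z + offDiagEnergy Z)
  have h4 := sq_abs (realTrace Z)
  rw [← h3, ← h4]
  have h5 : schattenOne Z ≤ |realTrace Z| + 4 * r := by linarith
  refine (pow_le_pow_left₀ (schattenOne_nonneg Z) h5 2).trans ?_
  nlinarith [sq_nonneg (4 * |realTrace Z| - r), sq_nonneg r, sq_nonneg (|realTrace Z|)]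

theorem schattenOne_sq_le_of_mem_boundedPeakSignals {X : Herm n} (hX : X ∈ psdCone n)
    {x₀ : EuclideanSpace ℂ (Fin n)} (h0 : x₀ ∈ boundedPeakSignals n (1 / 81)) :
    schattenOne (X - rankOne x₀) ^ 2 ≤ 20 * (realTrace (X - rankOne x₀) ^ 2 +
      offDiagEnergy (X - rankOne x₀)) := by
  obtain ⟨h0, hpeak⟩ := h0
  have hn : 0 < ‖x₀‖ := norm_pos_iff.2 h0
  set Z := X - rankOne x₀ with hZ
  have h1 := schattenOne_sub_rankOne_le hX h0
  have h2 := norm_toLin_le_of_norm_apply_le Z ((‖x₀‖⁻¹ : ℂ) • x₀)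
    (by rw [norm_smul, norm_inv, Complex.norm_real, norm_norm, inv_mul_cancel₀ hn.ne'])
    (μ := 1 / 81) (by norm_num) (fun j => by
      rw [PiLp.smul_apply, norm_smul, norm_inv, Complex.norm_real, norm_norm, inv_mul_le_iff₀ hn,
        mul_comm]
      exact (norm_le_pi_norm x₀.ofLp j).trans hpeak)
  rw [← hZ] at h1
  have h3 := Real.sq_sqrt (offDiagEnergy_nonneg Z)
  set r := √(offDiagEnergy Z)
  have hd : √(diagEnergy Z) ≤ schattenOne Z :=
    Real.sqrt_le_iff.2 ⟨schattenOne_nonneg Z, diagEnergy_le_schattenOne_sq Z⟩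
  have h4 := sq_abs (realTrace Z)
  rw [← h3, ← h4]
  have h5 : 77 / 81 * schattenOne Z ≤ |realTrace Z| + 4 * r := by linarith
  have h6 := pow_le_pow_left₀ (mul_nonneg (by norm_num) (schattenOne_nonneg Z)) h5 2
  nlinarith [sq_nonneg (4 * |realTrace Z| - r), sq_nonneg r, sq_nonneg (|realTrace Z|)]

/-- If the measurements of the error matrix have `ℓ₁` norm at least `c` times its Schatten-1
norm, then a solution of the program is within `2 c⁻¹ ‖w‖` of the signal, by comparison of its
objective value with that of the signal. -/
theorem schattenOne_le_of_isSolution {m : ℕ} {v : Fin m → EuclideanSpace ℂ (Fin n)}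
    {x₀ : EuclideanSpace ℂ (Fin n)} {w : Fin m → ℝ} {X : Herm n}
    (hX : IsSolution v (observation v x₀ w) X) {c : ℝ}
    (hc : c * schattenOne (X - rankOne x₀) ≤ ∑ i, |hsInner (rankOne (v i)) (X - rankOne x₀)|) :
    c * schattenOne (X - rankOne x₀) ≤ 2 * l1Norm w := by
  have hmem : rankOne x₀ ∈ psdCone n := Matrix.posSemidef_vecMulVec_self_star x₀.ofLp
  have hmin : l1Norm (measOp v X - observation v x₀ w) ≤
      l1Norm (measOp v (rankOne x₀) - observation v x₀ w) := hX.2 hmem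
  have hw : l1Norm (measOp v (rankOne x₀) - observation v x₀ w) = l1Norm w := by
    simp [l1Norm, measOp, observation, hsInner_rankOne_rankOne]
  rw [hw] at hmin
  refine hc.trans (le_trans ?_ (two_mul (l1Norm w) ▸ add_le_add_left hmin (l1Norm w)))
  rw [l1Norm, l1Norm, ← Finset.sum_add_distrib]
  refine Finset.sum_le_sum fun i _ => ?_
  have h : hsInner (rankOne (v i)) (X - rankOne x₀) =
      (measOp v X - observation v x₀ w) i + w i := by
    simp only [hsInner_sub, hsInner_rankOne_rankOne, measOp, observation, Pi.sub_apply]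
    ring
  rw [h]
  exact abs_add_le _ _

end Deterministic

/-! ### Subgaussian entries and their linear combinations -/

section Subgaussian

variable {Ω : Type*} [MeasurableSpace Ω] {P : Measure Ω}

theorem one_le_of_isSubgaussian [IsProbabilityMeasure P] {X : Ω → ℂ} {K : ℝ}
    (hvar : ∫ ω, ‖X ω‖ ^ 2 ∂P = 1) (hX : IsSubgaussian P X K) : 1 ≤ K := by
  have hint : Integrable (fun ω => ‖X ω‖ ^ 2) P := integrable_of_integral_eq_one hvar
  have h1 : (1 : ENNReal) ≤ psiTwoNorm P X := by
    refine le_iInf₂ fun t ⟨ht, hle⟩ => ?_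
    rw [ENNReal.one_le_ofReal]
    have hlow : ∫⁻ ω, ENNReal.ofReal (1 + ‖X ω‖ ^ 2 / t ^ 2) ∂P ≤ 2 := by
      refine le_trans (lintegral_mono fun ω => ENNReal.ofReal_le_ofReal ?_) hle
      rw [add_comm]
      exact Real.add_one_le_exp _
    have hint' : Integrable (fun ω => 1 + ‖X ω‖ ^ 2 / t ^ 2) P :=
      (integrable_const _).add (hint.div_const _)
    rw [← ofReal_integral_eq_lintegral_ofReal hint'
      (ae_of_all _ fun ω => by positivity), integral_add (integrable_const _) (hint.div_const _),
      integral_div, hvar, show (2 : ENNReal) = ENNReal.ofReal 2 by simp,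
      ENNReal.ofReal_le_ofReal_iff (by norm_num)] at hlow
    simp only [integral_const, probReal_univ, smul_eq_mul, mul_one] at hlow
    have h2 : 1 / t ^ 2 ≤ 1 := by linarith
    rw [div_le_one (by positivity)] at h2
    nlinarith
  exact ENNReal.one_le_ofReal.1 (h1.trans hX)

theorem lintegral_exp_le_of_isSubgaussian {X : Ω → ℂ} {K : ℝ} (hK : 0 < K)
    (hX : IsSubgaussian P X K) :
    ∫⁻ ω, ENNReal.ofReal (Real.exp (‖X ω‖ ^ 2 / (2 * K) ^ 2)) ∂P ≤ 2 := by
  have hlt : psiTwoNorm P X < ENNReal.ofReal (2 * K) :=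
    hX.trans_lt ((ENNReal.ofReal_lt_ofReal_iff (by linarith)).2 (by linarith))
  simp only [psiTwoNorm, iInf_lt_iff] at hlt
  obtain ⟨t, ⟨ht, hle⟩, hlt⟩ := hlt
  have htK := (ENNReal.ofReal_lt_ofReal_iff (by linarith)).1 hlt
  refine le_trans (lintegral_mono fun ω => ENNReal.ofReal_le_ofReal (Real.exp_le_exp.2 ?_)) hle
  gcongr

theorem integrable_and_integral_le_of_lintegral_ofReal_le {f : Ω → ℝ}
    (hf : Measurable f) (h0 : ∀ ω, 0 ≤ f ω) {C : ℝ} (hC : 0 ≤ C)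
    (h : ∫⁻ ω, ENNReal.ofReal (f ω) ∂P ≤ ENNReal.ofReal C) :
    Integrable f P ∧ ∫ ω, f ω ∂P ≤ C := by
  have hint : Integrable f P := by
    rw [← lintegral_ofReal_ne_top_iff_integrable hf.aestronglyMeasurable (ae_of_all _ h0)]
    exact (h.trans_lt ENNReal.ofReal_lt_top).ne
  refine ⟨hint, ?_⟩
  rw [← ofReal_integral_eq_lintegral_ofReal hint (ae_of_all _ h0)] at h
  exact (ENNReal.ofReal_le_ofReal_iff hC).1 h

theorem integrable_norm_pow_four_of_isSubgaussian {X : Ω → ℂ} (hX : Measurable X) {K : ℝ}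
    (hK : 0 < K) (hsub : IsSubgaussian P X K) : Integrable (fun ω => ‖X ω‖ ^ 4) P := by
  obtain ⟨h1, -⟩ := integrable_and_integral_le_of_lintegral_ofReal_le (C := 2)
    (f := fun ω => Real.exp (‖X ω‖ ^ 2 / (2 * K) ^ 2)) (by fun_prop)
    (fun ω => (Real.exp_pos _).le) (by norm_num)
    (by simpa using lintegral_exp_le_of_isSubgaussian hK hsub)
  refine (h1.const_mul (2 * (2 * K) ^ 4)).mono' (by fun_prop) (ae_of_all _ fun ω => ?_)
  have h := Real.pow_div_factorial_le_exp (‖X ω‖ ^ 2 / (2 * K) ^ 2) (by positivity) 2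
  rw [Real.norm_eq_abs, abs_of_nonneg (by positivity)]
  have h2 : ‖X ω‖ ^ 4 = 2 * (2 * K) ^ 4 * ((‖X ω‖ ^ 2 / (2 * K) ^ 2) ^ 2 / (Nat.factorial 2)) := by
    rw [Nat.factorial_two]
    push_cast
    field_simp
  rw [h2]
  gcongr

theorem exp_le_add_exp_sq (x : ℝ) : Real.exp x ≤ x + Real.exp (x ^ 2) := by
  rcases le_or_gt |x| 1 with h | h
  · have h1 := (abs_le.1 (Real.abs_exp_sub_one_sub_id_le h)).2
    linarith [Real.add_one_le_exp (x ^ 2)]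
  · rcases lt_abs.1 h with h | h
    · have : Real.exp x ≤ Real.exp (x ^ 2) := Real.exp_le_exp.2 (by nlinarith)
      linarith
    · have : Real.exp x ≤ 1 := Real.exp_le_one_iff.2 (by linarith)
      nlinarith [Real.add_one_le_exp (x ^ 2)]

theorem exp_mul_le_one_add_mul {θ : ℝ} (h0 : 0 ≤ θ) (h1 : θ ≤ 1) (y : ℝ) :
    Real.exp (θ * y) ≤ 1 + θ * (Real.exp y - 1) := by
  have h := convexOn_exp.2 (Set.mem_univ y) (Set.mem_univ 0) h0 (sub_nonneg.2 h1) (by ring)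
  simp only [smul_eq_mul, mul_zero, add_zero, Real.exp_zero, mul_one] at h
  linarith

/-- A centred real variable dominated by a subgaussian one has a Gaussian moment generating
function. For small arguments this uses `exp x ≤ x + exp (x²)`, where the linear term integrates to
zero, and for large ones the inequality `2 x y ≤ x² + y²`. -/
theorem hasSubgaussianMGF_of_abs_le [IsProbabilityMeasure P] {X : Ω → ℂ} {R : Ω → ℝ} {L a : ℝ}
    (hL : 0 < L) (ha : 0 ≤ a) (hR : Measurable R)
    (hX : Integrable (fun ω => Real.exp (‖X ω‖ ^ 2 / L ^ 2)) P)
    (hX2 : ∫ ω, Real.exp (‖X ω‖ ^ 2 / L ^ 2) ∂P ≤ 2)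
    (hRX : ∀ ω, |R ω| ≤ a * ‖X ω‖) (hmean : ∫ ω, R ω ∂P = 0) :
    HasSubgaussianMGF R (2 * L ^ 2 * a ^ 2).toNNReal P := by
  have hG : ∀ t ω, |t * R ω| ≤ (|t| * a * L) * (‖X ω‖ / L) := by
    intro t ω
    rw [abs_mul]
    have : |t| * a * L * (‖X ω‖ / L) = |t| * (a * ‖X ω‖) := by field_simp
    rw [this]
    exact mul_le_mul_of_nonneg_left (hRX ω) (abs_nonneg t)
  have hhalf : ∀ t ω, Real.exp (t * R ω) ≤
      Real.exp ((|t| * a * L) ^ 2 / 2) * (1 + 1 / 2 * (Real.exp (‖X ω‖ ^ 2 / L ^ 2) - 1)) := by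
    intro t ω
    refine le_trans ?_ (mul_le_mul_of_nonneg_left (exp_mul_le_one_add_mul (by norm_num)
      (by norm_num) _) (Real.exp_pos _).le)
    rw [← Real.exp_add]
    apply Real.exp_le_exp.2
    have := (le_abs_self _).trans (hG t ω)
    rw [← div_pow]
    nlinarith [sq_nonneg (|t| * a * L - ‖X ω‖ / L)]
  have hdom : ∀ t, Integrable (fun ω => Real.exp ((|t| * a * L) ^ 2 / 2) *
      (1 + 1 / 2 * (Real.exp (‖X ω‖ ^ 2 / L ^ 2) - 1))) P := fun t =>
    ((integrable_const _).add ((hX.sub (integrable_const _)).const_mul _)).const_mul _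
  have hexp : ∀ t, Integrable (fun ω => Real.exp (t * R ω)) P := fun t =>
    (hdom t).mono' (by fun_prop) (ae_of_all _ fun ω => by
      rw [Real.norm_eq_abs, Real.abs_exp]; exact hhalf t ω)
  have hRint : Integrable R P := by
    refine (hX.const_mul (a * L)).mono' (by fun_prop) (ae_of_all _ fun ω => ?_)
    rw [Real.norm_eq_abs]
    refine (hRX ω).trans ?_
    have h1 : ‖X ω‖ / L ≤ Real.exp (‖X ω‖ ^ 2 / L ^ 2) := by
      rw [← div_pow]
      nlinarith [Real.add_one_le_exp ((‖X ω‖ / L) ^ 2), sq_nonneg (‖X ω‖ / L - 1 / 2)]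
    have h2 : a * ‖X ω‖ = a * L * (‖X ω‖ / L) := by field_simp
    rw [h2]
    exact mul_le_mul_of_nonneg_left h1 (by positivity)
  refine ⟨hexp, fun t => ?_⟩
  have hc : ((2 * L ^ 2 * a ^ 2).toNNReal : ℝ) * t ^ 2 / 2 = (|t| * a * L) ^ 2 := by
    rw [Real.coe_toNNReal _ (by positivity), mul_pow, mul_pow, sq_abs]; ring
  rw [hc, mgf]
  set u := |t| * a * L with hu
  have hu0 : 0 ≤ u := by positivity
  rcases le_total u 1 with h1 | h1
  · have hle : ∀ ω, Real.exp (t * R ω) ≤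
        t * R ω + (1 + u ^ 2 * (Real.exp (‖X ω‖ ^ 2 / L ^ 2) - 1)) := by
      intro ω
      refine (exp_le_add_exp_sq _).trans (add_le_add_right ?_ _)
      refine le_trans ?_ (exp_mul_le_one_add_mul (sq_nonneg u) (by nlinarith) _)
      apply Real.exp_le_exp.2
      rw [← div_pow, ← mul_pow, ← sq_abs (t * R ω)]
      exact pow_le_pow_left₀ (abs_nonneg _) (hG t ω) 2
    have hi1 : Integrable (fun ω => u ^ 2 * (Real.exp (‖X ω‖ ^ 2 / L ^ 2) - 1)) P :=
      (hX.sub (integrable_const _)).const_mul _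
    have hi2 : Integrable (fun ω => 1 + u ^ 2 * (Real.exp (‖X ω‖ ^ 2 / L ^ 2) - 1)) P :=
      (integrable_const _).add hi1
    have hi := integral_mono (hexp t) ((hRint.const_mul t).add hi2) hle
    simp only [Pi.add_apply] at hi
    rw [integral_add (hRint.const_mul t) hi2, integral_const_mul, hmean,
      integral_add (integrable_const _) hi1, integral_const_mul,
      integral_sub hX (integrable_const _)] at hi
    simp only [integral_const, probReal_univ, smul_eq_mul, mul_one] at hi
    nlinarith [Real.add_one_le_exp (u ^ 2), sq_nonneg u]
  · have hi := integral_mono (hexp t) (hdom t) (hhalf t)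
    have hi1 : Integrable (fun ω => 1 / 2 * (Real.exp (‖X ω‖ ^ 2 / L ^ 2) - 1)) P :=
      (hX.sub (integrable_const _)).const_mul _
    rw [integral_const_mul, integral_add (integrable_const _) hi1, integral_const_mul,
      integral_sub hX (integrable_const _)] at hi
    simp only [integral_const, probReal_univ, smul_eq_mul, mul_one] at hi
    refine hi.trans ?_
    have h2 : Real.exp (u ^ 2) = Real.exp (u ^ 2 / 2) * Real.exp (u ^ 2 / 2) := by
      rw [← Real.exp_add]; ring_nf
    rw [h2]
    refine mul_le_mul_of_nonneg_left ?_ (Real.exp_pos _).le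
    nlinarith [Real.add_one_le_exp (u ^ 2 / 2)]

theorem lintegral_exp_neg_mul_sq {b : ℝ} (hb : 0 < b) :
    ∫⁻ g : ℝ, ENNReal.ofReal (Real.exp (-b * g ^ 2)) = ENNReal.ofReal √(Real.pi / b) := by
  rw [← integral_gaussian, ofReal_integral_eq_lintegral_ofReal (integrable_exp_neg_mul_sq hb)
    (ae_of_all _ fun g => (Real.exp_pos _).le)]

/-- The square exponential moment of a subgaussian variable, by linearizing the square with an
auxiliary Gaussian integral. -/
theorem lintegral_exp_sq_le [SFinite P] {R : Ω → ℝ} {c : NNReal} (hR : Measurable R)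
    (h : HasSubgaussianMGF R c P) {s : ℝ} (hs : 0 ≤ s) (hcs : c * s ≤ 1 / 4) :
    ∫⁻ ω, ENNReal.ofReal (Real.exp (s * R ω ^ 2)) ∂P ≤ ENNReal.ofReal √2 := by
  have hlin : ∀ r : ℝ, ENNReal.ofReal (Real.exp (s * r ^ 2)) * ENNReal.ofReal √Real.pi =
      ∫⁻ g : ℝ, ENNReal.ofReal (Real.exp (-g ^ 2)) * ENNReal.ofReal (Real.exp (2 * √s * g * r)) := by
    intro r
    have h1 : ∫⁻ g : ℝ, ENNReal.ofReal (Real.exp (-1 * (g - √s * r) ^ 2)) =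
        ENNReal.ofReal √Real.pi := by
      rw [lintegral_sub_right_eq_self (fun g => ENNReal.ofReal (Real.exp (-1 * g ^ 2))),
        lintegral_exp_neg_mul_sq one_pos, div_one]
    rw [← h1, ← lintegral_const_mul _ (by fun_prop)]
    refine lintegral_congr fun g => ?_
    rw [← ENNReal.ofReal_mul (Real.exp_pos _).le, ← ENNReal.ofReal_mul (Real.exp_pos _).le,
      ← Real.exp_add, ← Real.exp_add]
    congr 2
    linear_combination (r ^ 2) * (-Real.sq_sqrt hs)
  have hpi : ENNReal.ofReal √Real.pi ≠ 0 := by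
    simpa using Real.sqrt_pos.2 Real.pi_pos
  rw [← ENNReal.mul_le_mul_iff_left hpi ENNReal.ofReal_ne_top,
    ← lintegral_mul_const _ (by fun_prop)]
  simp_rw [hlin]
  rw [lintegral_lintegral_swap (by fun_prop)]
  calc ∫⁻ g : ℝ, ∫⁻ ω, ENNReal.ofReal (Real.exp (-g ^ 2)) *
          ENNReal.ofReal (Real.exp (2 * √s * g * R ω)) ∂P
      ≤ ∫⁻ g : ℝ, ENNReal.ofReal (Real.exp (-(1 / 2) * g ^ 2)) := by
        refine lintegral_mono fun g => ?_
        rw [lintegral_const_mul _ (by fun_prop), ← ofReal_integral_eq_lintegral_ofReal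
          (h.integrable_exp_mul _) (ae_of_all _ fun ω => (Real.exp_pos _).le),
          ← ENNReal.ofReal_mul (Real.exp_pos _).le]
        apply ENNReal.ofReal_le_ofReal
        refine (mul_le_mul_of_nonneg_left (h.mgf_le _) (Real.exp_pos _).le).trans ?_
        rw [← Real.exp_add]
        apply Real.exp_le_exp.2
        have h2 : (c : ℝ) * (2 * √s * g) ^ 2 / 2 = 2 * (c * s) * g ^ 2 := by
          rw [mul_pow, mul_pow, Real.sq_sqrt hs]; ring
        rw [h2]
        nlinarith [sq_nonneg g]
    _ = ENNReal.ofReal √2 * ENNReal.ofReal √Real.pi := by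
        rw [lintegral_exp_neg_mul_sq (by norm_num), ← ENNReal.ofReal_mul (Real.sqrt_nonneg _),
          ← Real.sqrt_mul (by norm_num)]
        congr 2
        ring

theorem hasSubgaussianMGF_re_inner [IsProbabilityMeasure P] {n : ℕ}
    {X : Ω → EuclideanSpace ℂ (Fin n)} {K : ℝ} (hK : 0 < K) (hX : Measurable X)
    (hind : iIndepFun (fun (j : Fin n) ω => X ω j) P) (hmean : ∀ j, ∫ ω, X ω j ∂P = 0)
    (hsub : ∀ j, IsSubgaussian P (fun ω => X ω j) K) (v : EuclideanSpace ℂ (Fin n)) (hv : ‖v‖ ≤ 1) :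
    HasSubgaussianMGF (fun ω => (inner ℂ v (X ω)).re) (8 * K ^ 2).toNNReal P := by
  have hXj : ∀ j, Measurable fun ω => X ω j := fun j => by fun_prop
  have hterm : ∀ j, HasSubgaussianMGF (fun ω => (X ω j * starRingEnd ℂ (v j)).re)
      (2 * (2 * K) ^ 2 * ‖v j‖ ^ 2).toNNReal P := by
    intro j
    obtain ⟨h1, h2⟩ := integrable_and_integral_le_of_lintegral_ofReal_le (C := 2)
      (f := fun ω => Real.exp (‖X ω j‖ ^ 2 / (2 * K) ^ 2)) (by fun_prop)
      (fun ω => (Real.exp_pos _).le) (by norm_num)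
      (by simpa using lintegral_exp_le_of_isSubgaussian hK (hsub j))
    refine hasSubgaussianMGF_of_abs_le (X := fun ω => X ω j) (by linarith) (norm_nonneg _)
      (by fun_prop) h1 h2 (fun ω => ?_) ?_
    · refine (Complex.abs_re_le_norm _).trans ?_
      rw [norm_mul, RCLike.norm_conj, mul_comm]
    · have hint : Integrable (fun ω => X ω j) P := by
        refine (h1.const_mul (2 * K)).mono' (hXj j).aestronglyMeasurable (ae_of_all _ fun ω => ?_)
        have h3 : ‖X ω j‖ / (2 * K) ≤ Real.exp (‖X ω j‖ ^ 2 / (2 * K) ^ 2) := by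
          rw [← div_pow]
          nlinarith [Real.add_one_le_exp ((‖X ω j‖ / (2 * K)) ^ 2),
            sq_nonneg (‖X ω j‖ / (2 * K) - 1 / 2)]
        rw [div_le_iff₀ (by linarith)] at h3
        linarith
      have h4 := integral_re (𝕜 := ℂ) (hint.mul_const (starRingEnd ℂ (v j)))
      simp only [RCLike.re_to_complex] at h4
      rw [h4, integral_mul_const, hmean j, zero_mul, Complex.zero_re]
  have hsum := HasSubgaussianMGF.sum_of_iIndepFun (s := Finset.univ)
    (hind.comp (fun j z => (z * starRingEnd ℂ (v j)).re) (fun j => by fun_prop))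
    (fun j _ => hterm j)
  refine ⟨fun t => ?_, fun t => ?_⟩
  · have := hsum.integrable_exp_mul t
    simpa [PiLp.inner_apply, RCLike.inner_apply, Function.comp_def] using this
  · have := hsum.mgf_le t
    simp only [Function.comp_def] at this
    simp only [PiLp.inner_apply, RCLike.inner_apply, Complex.re_sum]
    refine this.trans (Real.exp_le_exp.2 ?_)
    have h5 : ((∑ j, (2 * (2 * K) ^ 2 * ‖v j‖ ^ 2).toNNReal : NNReal) : ℝ) ≤
        ((8 * K ^ 2).toNNReal : ℝ) := by
      rw [NNReal.coe_sum, Real.coe_toNNReal _ (by positivity)]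
      simp_rw [fun j => Real.coe_toNNReal (2 * (2 * K) ^ 2 * ‖v j‖ ^ 2) (by positivity)]
      rw [← Finset.mul_sum, ← EuclideanSpace.norm_sq_eq]
      have : ‖v‖ ^ 2 ≤ 1 := pow_le_one₀ (norm_nonneg _) hv
      nlinarith [sq_nonneg K]
    gcongr

theorem lintegral_exp_norm_inner_sq_le [IsProbabilityMeasure P] {n : ℕ}
    {X : Ω → EuclideanSpace ℂ (Fin n)} {K : ℝ} (hK : 0 < K) (hX : Measurable X)
    (hind : iIndepFun (fun (j : Fin n) ω => X ω j) P) (hmean : ∀ j, ∫ ω, X ω j ∂P = 0)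
    (hsub : ∀ j, IsSubgaussian P (fun ω => X ω j) K) (v : EuclideanSpace ℂ (Fin n)) (hv : ‖v‖ ≤ 1) :
    ∫⁻ ω, ENNReal.ofReal (Real.exp (‖inner ℂ v (X ω)‖ ^ 2 / (64 * K ^ 2))) ∂P ≤ 2 := by
  have hre : ∀ u : EuclideanSpace ℂ (Fin n), ‖u‖ ≤ 1 →
      ∫⁻ ω, ENNReal.ofReal (Real.exp (1 / (32 * K ^ 2) * (inner ℂ u (X ω)).re ^ 2)) ∂P ≤ 2 := by
    intro u hu
    refine (lintegral_exp_sq_le (by fun_prop)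
      (hasSubgaussianMGF_re_inner hK hX hind hmean hsub u hu) (by positivity) ?_).trans ?_
    · rw [Real.coe_toNNReal _ (by positivity)]
      field_simp
      norm_num
    · rw [show (2 : ENNReal) = ENNReal.ofReal 2 by simp]
      apply ENNReal.ofReal_le_ofReal
      rw [Real.sqrt_le_left (by norm_num)]
      norm_num
  -- The imaginary part of `⟨v, x⟩` is the real part of `⟨i v, x⟩`.
  have him : ∀ ω, (inner ℂ v (X ω)).im = (inner ℂ (Complex.I • v) (X ω)).re := by
    intro ω
    rw [inner_smul_left]
    simp
  have hI : ‖Complex.I • v‖ ≤ 1 := by rw [norm_smul, Complex.norm_I, one_mul]; exact hv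
  have hpt : ∀ ω, ENNReal.ofReal (Real.exp (‖inner ℂ v (X ω)‖ ^ 2 / (64 * K ^ 2))) ≤
      2⁻¹ * (ENNReal.ofReal (Real.exp (1 / (32 * K ^ 2) * (inner ℂ v (X ω)).re ^ 2)) +
        ENNReal.ofReal (Real.exp (1 / (32 * K ^ 2) * (inner ℂ (Complex.I • v) (X ω)).re ^ 2))) := by
    intro ω
    rw [← ENNReal.ofReal_add (Real.exp_pos _).le (Real.exp_pos _).le,
      show (2⁻¹ : ENNReal) = ENNReal.ofReal 2⁻¹ by
        rw [ENNReal.ofReal_inv_of_pos (by norm_num)]; simp,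
      ← ENNReal.ofReal_mul (by norm_num), ← him]
    apply ENNReal.ofReal_le_ofReal
    have h := convexOn_exp.2 (Set.mem_univ (1 / (32 * K ^ 2) * (inner ℂ v (X ω)).re ^ 2))
      (Set.mem_univ (1 / (32 * K ^ 2) * (inner ℂ v (X ω)).im ^ 2))
      (show (0 : ℝ) ≤ 2⁻¹ by norm_num) (show (0 : ℝ) ≤ 2⁻¹ by norm_num) (by norm_num)
    simp only [smul_eq_mul] at h
    rw [mul_add]
    refine le_trans (le_of_eq ?_) h
    congr 1
    rw [← Complex.normSq_eq_norm_sq, Complex.normSq_apply]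
    field_simp
    ring
  refine (lintegral_mono hpt).trans ?_
  rw [lintegral_const_mul _ (by fun_prop), lintegral_add_left (by fun_prop)]
  calc _ ≤ (2⁻¹ : ENNReal) * (2 + 2) := by gcongr; exacts [hre v hv, hre _ hI]
    _ = 2 := by rw [← two_mul, ← mul_assoc, ENNReal.inv_mul_cancel (by simp) (by simp), one_mul]

end Subgaussian

/-! ### The second moment of a quadratic form -/

section SecondMoment

variable {Ω : Type*} [MeasurableSpace Ω] {P : Measure Ω}

/-- The fourth-order mixed moments of independent centred complex variables of variance one with
common pseudo-variance `σ` and fourth absolute moment `κ`: the Gaussian pairings plus a cumulant. -/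
theorem integral_conj_mul_mul_conj_mul [IsProbabilityMeasure P] {n : ℕ}
    {X : Ω → EuclideanSpace ℂ (Fin n)} (hX : Measurable X)
    (hind : iIndepFun (fun (j : Fin n) ω => X ω j) P) (hmean : ∀ j, ∫ ω, X ω j ∂P = 0)
    (hvar : ∀ j, ∫ ω, ‖X ω j‖ ^ 2 ∂P = 1) {σ : ℂ} (hσ : ∀ j, ∫ ω, X ω j ^ 2 ∂P = σ)
    {κ : ℝ} (hκ : ∀ j, ∫ ω, ‖X ω j‖ ^ 4 ∂P = κ) (j k p q : Fin n) :
    ∫ ω, starRingEnd ℂ (X ω j) * X ω k * (starRingEnd ℂ (X ω p) * X ω q) ∂P =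
      (if j = k then 1 else 0) * (if p = q then 1 else 0) +
      (if j = q then 1 else 0) * (if k = p then 1 else 0) +
      (‖σ‖ ^ 2 : ℝ) * ((if j = p then 1 else 0) * (if k = q then 1 else 0)) +
      (κ - 2 - ‖σ‖ ^ 2 : ℝ) *
        ((if j = k then 1 else 0) * ((if j = p then 1 else 0) * (if j = q then 1 else 0))) := by
  have hXj : ∀ j, Measurable fun ω => X ω j := fun j => by fun_prop
  have hmean' : ∀ j, ∫ ω, starRingEnd ℂ (X ω j) ∂P = 0 := fun j => by
    rw [integral_conj, hmean, map_zero]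
  have hvar1 : ∀ j, ∫ ω, starRingEnd ℂ (X ω j) * X ω j ∂P = 1 := fun j => by
    simp_rw [Complex.conj_mul', ← Complex.ofReal_pow]
    rw [integral_complex_ofReal, hvar, Complex.ofReal_one]
  have hvar2 : ∀ j, ∫ ω, X ω j * starRingEnd ℂ (X ω j) ∂P = 1 := fun j => by
    simp_rw [mul_comm (X _ j)]; exact hvar1 j
  have hσ1 : ∀ j, ∫ ω, X ω j * X ω j ∂P = σ := fun j => by simp_rw [← sq]; exact hσ j
  have hσ2 : ∀ j, ∫ ω, starRingEnd ℂ (X ω j) * starRingEnd ℂ (X ω j) ∂P = starRingEnd ℂ σ :=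
    fun j => by simp_rw [← map_mul]; rw [integral_conj, hσ1]
  have hκ1 : ∀ j, ∫ ω, starRingEnd ℂ (X ω j) * X ω j * starRingEnd ℂ (X ω j) * X ω j ∂P = κ :=
    fun j => by
      simp_rw [mul_assoc _ (starRingEnd ℂ (X _ j)), Complex.conj_mul', ← Complex.ofReal_pow,
        ← Complex.ofReal_mul]
      rw [integral_complex_ofReal, ← hκ j]
      congr 1
      exact integral_congr_ae (ae_of_all _ fun ω => by ring)
  let f : Fin n → ℂ → ℂ := fun l z => (if l = j then starRingEnd ℂ z else 1) *
    (if l = k then z else 1) * (if l = p then starRingEnd ℂ z else 1) * (if l = q then z else 1)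
  have hf : ∀ l, Measurable (f l) := fun l => by
    simp only [f]; split_ifs <;> fun_prop
  have hprod : ∀ ω, starRingEnd ℂ (X ω j) * X ω k * (starRingEnd ℂ (X ω p) * X ω q) =
      ∏ l, f l (X ω l) := fun ω => by
    simp only [f, Finset.prod_mul_distrib, Finset.prod_ite_eq', Finset.mem_univ, if_true]
    ring
  simp_rw [hprod]
  rw [hind.integral_fun_prod_comp (fun l => (hXj l).aemeasurable)
    (fun l => (hf l).aestronglyMeasurable)]
  have hone : ∀ l, l ≠ j → l ≠ k → l ≠ p → l ≠ q → ∫ ω, f l (X ω l) ∂P = 1 := by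
    intro l h1 h2 h3 h4
    simp [f, h1, h2, h3, h4]
  by_cases hjk : j = k
  · subst hjk
    by_cases hpq : p = q
    · subst hpq
      by_cases hjp : j = p
      · subst hjp
        rw [Finset.prod_eq_single j (fun l _ hl => hone l hl hl hl hl) (by simp)]
        simp only [f, if_true, hκ1]
        push_cast
        ring
      · rw [Finset.prod_eq_one]
        · simp [hjp]
        · intro l _
          by_cases h1 : l = j
          · subst h1; simp [f, hjp, hvar1]
          · by_cases h2 : l = p
            · subst h2; simp [f, h1, hvar1]
            · exact hone l h1 h1 h2 h2
    · by_cases hjp : j = p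
      · subst hjp
        rw [Finset.prod_eq_zero (Finset.mem_univ q) (by simp [f, Ne.symm hpq, hmean])]
        simp [hpq]
      · rw [Finset.prod_eq_zero (Finset.mem_univ p)
          (by simp [f, Ne.symm hjp, hpq, hmean'])]
        simp [hjp, hpq]
  · by_cases hjp : j = p
    · subst hjp
      by_cases hkq : k = q
      · subst hkq
        rw [Finset.prod_eq_mul j k hjk (fun l _ hl => hone l hl.1 hl.2 hl.1 hl.2) (by simp)
          (by simp)]
        simp [f, hjk, Ne.symm hjk, hσ1, hσ2, Complex.conj_mul']
      · rw [Finset.prod_eq_zero (Finset.mem_univ k) (by simp [f, Ne.symm hjk, hkq, hmean])]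
        simp [hjk, Ne.symm hjk, hkq]
    · by_cases hjq : j = q
      · subst hjq
        by_cases hkp : k = p
        · subst hkp
          rw [Finset.prod_eq_one]
          · simp [hjk]
          · intro l _
            by_cases h1 : l = j
            · subst h1; simp [f, hjk, hvar1]
            · by_cases h2 : l = k
              · subst h2; simp [f, h1, hvar2]
              · exact hone l h1 h2 h2 h1
        · rw [Finset.prod_eq_zero (Finset.mem_univ k) (by simp [f, Ne.symm hjk, hkp, hmean])]
          simp [hjk, hkp, hjp]
      · rw [Finset.prod_eq_zero (Finset.mem_univ j) (by simp [f, hjk, hjp, hjq, hmean'])]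
        simp [hjk, hjp, hjq]

theorem sum_mul_mul_pairings {n : ℕ} (A : Matrix (Fin n) (Fin n) ℂ) (s t : ℂ) :
    ∑ j, ∑ k, ∑ p, ∑ q, A j k * A p q *
      ((if j = k then 1 else 0) * (if p = q then 1 else 0) +
      (if j = q then 1 else 0) * (if k = p then 1 else 0) +
      s * ((if j = p then 1 else 0) * (if k = q then 1 else 0)) +
      t * ((if j = k then 1 else 0) * ((if j = p then 1 else 0) * (if j = q then 1 else 0)))) =
    (∑ j, A j j) ^ 2 + ∑ j, ∑ k, A j k * A k j + s * ∑ j, ∑ k, A j k ^ 2 +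
      t * ∑ j, A j j ^ 2 := by
  simp only [mul_add, Finset.sum_add_distrib]
  congr 1
  · congr 1
    · congr 1
      · simp [sq, Finset.sum_mul_sum, ← Finset.mul_sum]
      · simp
    · simp only [mul_ite, mul_one, mul_zero, Finset.sum_ite_eq, Finset.mem_univ, if_true,
        Finset.mul_sum]
      exact Finset.sum_congr rfl fun j _ => Finset.sum_congr rfl fun k _ => by ring
  · simp only [mul_ite, mul_one, mul_zero, Finset.sum_ite_eq, Finset.mem_univ, if_true,
      Finset.mul_sum]
    exact Finset.sum_congr rfl fun j _ => by ring

theorem integrable_mul_mul_mul [IsFiniteMeasure P] {n : ℕ}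
    {X : Ω → EuclideanSpace ℂ (Fin n)} (hX : Measurable X)
    (hint : ∀ j, Integrable (fun ω => ‖X ω j‖ ^ 4) P) (j k p q : Fin n) :
    Integrable (fun ω => starRingEnd ℂ (X ω j) * X ω k * (starRingEnd ℂ (X ω p) * X ω q)) P := by
  have hXj : ∀ j, Measurable fun ω => X ω j := fun j => by fun_prop
  refine (((hint j).add (hint k)).add ((hint p).add (hint q))).mono'
    (by fun_prop) (ae_of_all _ fun ω => ?_)
  simp only [norm_mul, RCLike.norm_conj, Pi.add_apply]
  set a := ‖X ω j‖
  set b := ‖X ω k‖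
  set c := ‖X ω p‖
  set d := ‖X ω q‖
  nlinarith [sq_nonneg (a * b - c * d), sq_nonneg (a ^ 2 - b ^ 2), sq_nonneg (c ^ 2 - d ^ 2),
    sq_nonneg (a ^ 2), sq_nonneg (b ^ 2), sq_nonneg (c ^ 2), sq_nonneg (d ^ 2)]

theorem integral_hsInner_rankOne_sq [IsProbabilityMeasure P] {n : ℕ}
    {X : Ω → EuclideanSpace ℂ (Fin n)} (hX : Measurable X)
    (hind : iIndepFun (fun (j : Fin n) ω => X ω j) P) (hmean : ∀ j, ∫ ω, X ω j ∂P = 0)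
    (hvar : ∀ j, ∫ ω, ‖X ω j‖ ^ 2 ∂P = 1) {σ : ℂ} (hσ : ∀ j, ∫ ω, X ω j ^ 2 ∂P = σ)
    {κ : ℝ} (hκ : ∀ j, ∫ ω, ‖X ω j‖ ^ 4 ∂P = κ)
    (hint : ∀ j, Integrable (fun ω => ‖X ω j‖ ^ 4) P) (Z : Herm n) :
    ((∫ ω, hsInner (rankOne (X ω)) Z ^ 2 ∂P : ℝ) : ℂ) =
      (∑ j, (Z : Matrix (Fin n) (Fin n) ℂ) j j) ^ 2 +
      ∑ j, ∑ k, (Z : Matrix (Fin n) (Fin n) ℂ) j k * (Z : Matrix (Fin n) (Fin n) ℂ) k j +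
      (‖σ‖ ^ 2 : ℝ) * ∑ j, ∑ k, (Z : Matrix (Fin n) (Fin n) ℂ) j k ^ 2 +
      (κ - 2 - ‖σ‖ ^ 2 : ℝ) * ∑ j, (Z : Matrix (Fin n) (Fin n) ℂ) j j ^ 2 := by
  rw [← integral_complex_ofReal, ← sum_mul_mul_pairings (Z : Matrix (Fin n) (Fin n) ℂ)]
  have hexp : ∀ ω, ((hsInner (rankOne (X ω)) Z ^ 2 : ℝ) : ℂ) =
      ∑ j, ∑ k, ∑ p, ∑ q, (Z : Matrix (Fin n) (Fin n) ℂ) j k *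
        (Z : Matrix (Fin n) (Fin n) ℂ) p q *
        (starRingEnd ℂ (X ω j) * X ω k * (starRingEnd ℂ (X ω p) * X ω q)) := by
    intro ω
    rw [Complex.ofReal_pow, ← inner_toLin_eq_ofReal, inner_toLin_eq_sum, sq]
    simp only [Finset.sum_mul, Finset.mul_sum]
    exact Finset.sum_congr rfl fun j _ => Finset.sum_congr rfl fun k _ =>
      Finset.sum_congr rfl fun p _ => Finset.sum_congr rfl fun q _ => by ring
  simp_rw [hexp]
  have hi := fun j k p q => (integrable_mul_mul_mul hX hint j k p q).const_mul
    ((Z : Matrix (Fin n) (Fin n) ℂ) j k * (Z : Matrix (Fin n) (Fin n) ℂ) p q)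
  rw [integral_finsetSum _ fun j _ => integrable_finsetSum _ fun k _ =>
    integrable_finsetSum _ fun p _ => integrable_finsetSum _ fun q _ => hi j k p q]
  refine Finset.sum_congr rfl fun j _ => ?_
  rw [integral_finsetSum _ fun k _ =>
    integrable_finsetSum _ fun p _ => integrable_finsetSum _ fun q _ => hi j k p q]
  refine Finset.sum_congr rfl fun k _ => ?_
  rw [integral_finsetSum _ fun p _ => integrable_finsetSum _ fun q _ => hi j k p q]
  refine Finset.sum_congr rfl fun p _ => ?_
  rw [integral_finsetSum _ fun q _ => hi j k p q]
  refine Finset.sum_congr rfl fun q _ => ?_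
  rw [integral_const_mul, integral_conj_mul_mul_conj_mul hX hind hmean hvar hσ hκ]

theorem le_integral_hsInner_rankOne_sq [IsProbabilityMeasure P] {n : ℕ}
    {X : Ω → EuclideanSpace ℂ (Fin n)} (hX : Measurable X)
    (hind : iIndepFun (fun (j : Fin n) ω => X ω j) P) (hmean : ∀ j, ∫ ω, X ω j ∂P = 0)
    (hvar : ∀ j, ∫ ω, ‖X ω j‖ ^ 2 ∂P = 1) {σ : ℂ} (hσ : ∀ j, ∫ ω, X ω j ^ 2 ∂P = σ)
    {κ : ℝ} (hκ : ∀ j, ∫ ω, ‖X ω j‖ ^ 4 ∂P = κ)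
    (hint : ∀ j, Integrable (fun ω => ‖X ω j‖ ^ 4) P) (Z : Herm n) :
    realTrace Z ^ 2 + (κ - 1) * diagEnergy Z + (1 - ‖σ‖ ^ 2) * offDiagEnergy Z ≤
      ∫ ω, hsInner (rankOne (X ω)) Z ^ 2 ∂P := by
  set M := (Z : Matrix (Fin n) (Fin n) ℂ) with hM
  have hdiag : ∀ j, M j j = ((M j j).re : ℂ) := fun j =>
    (Complex.conj_eq_iff_re.1 (Z.isHermitian.apply j j)).symm
  have hnorm : ∀ j, ‖M j j‖ ^ 2 = (M j j).re ^ 2 := fun j => by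
    conv_lhs => rw [hdiag j]
    rw [Complex.norm_real, Real.norm_eq_abs, sq_abs]
  have h := congrArg Complex.re (integral_hsInner_rankOne_sq hX hind hmean hvar hσ hκ hint Z)
  rw [← hM, Complex.ofReal_re] at h
  have h1 : ((∑ j, M j j) ^ 2).re = realTrace Z ^ 2 := by
    rw [Finset.sum_congr rfl fun j _ => hdiag j, ← Complex.ofReal_sum, ← Complex.ofReal_pow,
      Complex.ofReal_re]
    rfl
  have h2 : (∑ j, ∑ k, M j k * M k j).re = diagEnergy Z + offDiagEnergy Z := by
    rw [← sum_norm_sq_eq_diagEnergy_add]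
    simp only [Complex.re_sum]
    refine Finset.sum_congr rfl fun j _ => Finset.sum_congr rfl fun k _ => ?_
    have : M k j = starRingEnd ℂ (M j k) := (Z.isHermitian.apply k j).symm
    rw [this, Complex.mul_conj', ← Complex.ofReal_pow, Complex.ofReal_re]
  have h3 : diagEnergy Z - offDiagEnergy Z ≤ (∑ j, ∑ k, M j k ^ 2).re := by
    simp only [Complex.re_sum, diagEnergy, offDiagEnergy]
    rw [← Finset.sum_sub_distrib]
    refine Finset.sum_le_sum fun j _ => ?_
    rw [← Finset.sum_erase_add _ _ (Finset.mem_univ j),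
      ← Finset.sum_erase_add Finset.univ (fun k => (M j k ^ 2).re) (Finset.mem_univ j),
      if_pos rfl, add_zero, ← hM, sub_eq_neg_add, ← Finset.sum_neg_distrib]
    refine add_le_add (Finset.sum_le_sum fun k hk => ?_) (le_of_eq ?_)
    · rw [if_neg (Finset.ne_of_mem_erase hk).symm, ← norm_pow]
      exact neg_le_of_abs_le (Complex.abs_re_le_norm _)
    · rw [hnorm]
      conv_rhs => rw [hdiag j]
      rw [← Complex.ofReal_pow, Complex.ofReal_re]
  have h4 : (∑ j, M j j ^ 2).re = diagEnergy Z := by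
    simp only [Complex.re_sum, diagEnergy]
    refine Finset.sum_congr rfl fun j _ => ?_
    rw [← hM, hnorm]
    conv_lhs => rw [hdiag j]
    rw [← Complex.ofReal_pow, Complex.ofReal_re]
  simp only [Complex.add_re, Complex.re_ofReal_mul, h1, h2, h4] at h
  have h5 := mul_le_mul_of_nonneg_left h3 (sq_nonneg ‖σ‖)
  rw [h]
  linarith

end SecondMoment

/-! ### Lower bound for the first absolute moment -/

section FirstMoment

variable {Ω : Type*} [MeasurableSpace Ω] {P : Measure Ω}

theorem lintegral_exp_abs_hsInner_le {n : ℕ} {X : Ω → EuclideanSpace ℂ (Fin n)}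
    (hX : Measurable X) {c : ℝ} (hc : 0 < c)
    (hexp : ∀ v : EuclideanSpace ℂ (Fin n), ‖v‖ ≤ 1 →
      ∫⁻ ω, ENNReal.ofReal (Real.exp (‖inner ℂ v (X ω)‖ ^ 2 / c)) ∂P ≤ 2)
    (Z : Herm n) (hZ : 0 < schattenOne Z) :
    ∫⁻ ω, ENNReal.ofReal (Real.exp (|hsInner (rankOne (X ω)) Z| / (c * schattenOne Z))) ∂P ≤ 2 := by
  set v := Z.isHermitian.eigenvectorBasis
  set l := Z.isHermitian.eigenvalues
  set N := schattenOne Z with hN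
  have hw : ∑ k, |l k| / N = 1 := by
    rw [← Finset.sum_div]; exact div_self hZ.ne'
  -- Jensen's inequality for the convex combination with weights `|λ_k| / ∑ |λ_k|`.
  have hpt : ∀ ω, ENNReal.ofReal (Real.exp (|hsInner (rankOne (X ω)) Z| / (c * N))) ≤
      ∑ k, ENNReal.ofReal (|l k| / N) *
        ENNReal.ofReal (Real.exp (‖inner ℂ (v k) (X ω)‖ ^ 2 / c)) := by
    intro ω
    simp_rw [← ENNReal.ofReal_mul (div_nonneg (abs_nonneg (l _)) hZ.le)]
    rw [← ENNReal.ofReal_sum_of_nonneg fun k _ => by positivity]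
    apply ENNReal.ofReal_le_ofReal
    have h := convexOn_exp.map_sum_le (t := Finset.univ) (w := fun k => |l k| / N)
      (p := fun k => ‖inner ℂ (v k) (X ω)‖ ^ 2 / c) (fun k _ => by positivity) hw
      (fun k _ => Set.mem_univ _)
    refine le_trans (Real.exp_le_exp.2 ?_) h
    rw [hsInner_rankOne_eq_sum_eigenvalues, div_le_iff₀ (by positivity), Finset.sum_mul]
    refine (Finset.abs_sum_le_sum_abs _ _).trans (Finset.sum_le_sum fun k _ => ?_)
    rw [abs_mul, abs_pow, abs_norm, smul_eq_mul]
    apply le_of_eq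
    field_simp
    rfl
  refine (lintegral_mono hpt).trans ?_
  rw [lintegral_finsetSum _ fun k _ => by fun_prop]
  calc ∑ k, ∫⁻ ω, ENNReal.ofReal (|l k| / N) *
          ENNReal.ofReal (Real.exp (‖inner ℂ (v k) (X ω)‖ ^ 2 / c)) ∂P
      ≤ ∑ k, ENNReal.ofReal (|l k| / N) * 2 := by
        refine Finset.sum_le_sum fun k _ => ?_
        rw [lintegral_const_mul _ (by fun_prop)]
        gcongr
        exact hexp _ (v.orthonormal.1 k).le
    _ = 2 := by
        rw [← Finset.sum_mul, ← ENNReal.ofReal_sum_of_nonneg fun k _ => by positivity, hw,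
          ENNReal.ofReal_one, one_mul]

/-- A second moment bound passes to the first moment: since `y² ≤ τ y + y⁶ / τ⁴`, it suffices that
`τ` is so large that the sixth moment (at most `720 E exp y`) contributes at most half. -/
theorem le_integral_of_le_integral_sq [IsProbabilityMeasure P] {y : Ω → ℝ} (hy : Measurable y)
    (h0 : ∀ ω, 0 ≤ y ω) (hexp : ∫⁻ ω, ENNReal.ofReal (Real.exp (y ω)) ∂P ≤ 2) {ρ τ : ℝ}
    (hτ : 0 < τ) (hρ : ρ ≤ ∫ ω, y ω ^ 2 ∂P) (hτρ : 1440 / τ ^ 4 ≤ ρ / 2) :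
    ρ / (2 * τ) ≤ ∫ ω, y ω ∂P := by
  obtain ⟨h1, h2⟩ := integrable_and_integral_le_of_lintegral_ofReal_le (C := 2)
    (f := fun ω => Real.exp (y ω)) (by fun_prop) (fun ω => (Real.exp_pos _).le) (by norm_num)
    (by simpa using hexp)
  have hpow : ∀ k : ℕ, Integrable (fun ω => y ω ^ k) P := fun k =>
    (h1.const_mul (k.factorial : ℝ)).mono' (by fun_prop) (ae_of_all _ fun ω => by
      rw [Real.norm_eq_abs, abs_of_nonneg (pow_nonneg (h0 ω) k), mul_comm]
      exact (div_le_iff₀ (by positivity)).1 (Real.pow_div_factorial_le_exp _ (h0 ω) k))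
  have hy1 : Integrable y P := by simpa using hpow 1
  have h6 : ∫ ω, y ω ^ 6 ∂P ≤ 1440 := by
    have h := integral_mono (hpow 6) (h1.const_mul 720) fun ω => by
      have := Real.pow_div_factorial_le_exp _ (h0 ω) 6
      rw [div_le_iff₀ (by positivity)] at this
      norm_num [Nat.factorial] at this ⊢
      linarith
    rw [integral_const_mul] at h
    linarith
  have hpt : ∀ ω, y ω ^ 2 ≤ τ * y ω + y ω ^ 6 / τ ^ 4 := by
    intro ω
    rcases le_total (y ω) τ with h | h
    · have : 0 ≤ y ω ^ 6 / τ ^ 4 := by have := h0 ω; positivity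
      nlinarith [h0 ω]
    · have h3 : y ω ^ 2 ≤ y ω ^ 6 / τ ^ 4 := by
        rw [le_div_iff₀ (by positivity), show y ω ^ 6 = y ω ^ 2 * y ω ^ 4 by ring]
        gcongr
      have := mul_nonneg hτ.le (h0 ω)
      linarith
  have h := integral_mono (hpow 2) ((hy1.const_mul τ).add ((hpow 6).div_const _)) hpt
  simp only [Pi.add_apply] at h
  rw [integral_add (hy1.const_mul τ) ((hpow 6).div_const _), integral_const_mul,
    integral_div] at h
  have h7 : (∫ ω, y ω ^ 6 ∂P) / τ ^ 4 ≤ 1440 / τ ^ 4 := by gcongr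
  rw [div_le_iff₀ (by positivity)]
  linarith

/-- The first absolute moment of a normalized measurement: after scaling it to be subexponential at
scale one, `le_integral_of_le_integral_sq` applies with `τ` of order `K / b`. -/
theorem le_integral_abs_hsInner [IsProbabilityMeasure P] {n : ℕ}
    {X : Ω → EuclideanSpace ℂ (Fin n)} (hX : Measurable X) {K b : ℝ} (hK : 0 < K) (hb : 0 < b)
    (hexp : ∀ v : EuclideanSpace ℂ (Fin n), ‖v‖ ≤ 1 →
      ∫⁻ ω, ENNReal.ofReal (Real.exp (‖inner ℂ v (X ω)‖ ^ 2 / (64 * K ^ 2))) ∂P ≤ 2)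
    (Z : Herm n) (hZ : 0 < schattenOne Z)
    (hsq : b ^ 4 / 20 * schattenOne Z ^ 2 ≤ ∫ ω, hsInner (rankOne (X ω)) Z ^ 2 ∂P) :
    b ^ 5 / (327680 * K ^ 3) * schattenOne Z ≤ ∫ ω, |hsInner (rankOne (X ω)) Z| ∂P := by
  have hmeas : Measurable fun ω => hsInner (rankOne (X ω)) Z := by
    simp_rw [hsInner_rankOne_eq_sum_eigenvalues]
    fun_prop
  set N := schattenOne Z
  set D := 64 * K ^ 2 * N with hD
  have hD0 : 0 < D := by positivity
  -- The value of `τ` is admissible because `128 ^ 4` exceeds `2880 * 81920`.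
  have h := le_integral_of_le_integral_sq
    (y := fun ω => |hsInner (rankOne (X ω)) Z| / D) (ρ := b ^ 4 / (81920 * K ^ 4))
    (τ := 128 * K / b) (by fun_prop) (fun ω => by positivity)
    (lintegral_exp_abs_hsInner_le hX (by positivity) hexp Z hZ) (by positivity) ?_ ?_
  · rw [integral_div, le_div_iff₀ hD0] at h
    refine le_trans (le_of_eq ?_) h
    rw [hD]
    field_simp
    norm_num
  · simp only [div_pow, sq_abs]
    rw [integral_div, le_div_iff₀ (by positivity)]
    refine le_trans (le_of_eq ?_) hsq
    rw [hD]
    field_simp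
    norm_num
  · rw [div_pow, mul_pow]
    field_simp
    norm_num

end FirstMoment

/-! ### Symmetrization and contraction for exponential moments of suprema -/

section Symmetrization

variable {ι : Type*}

/-- The exponential `exp (sup a)` of the supremum of a real family, as an extended nonnegative
real. -/
noncomputable def expSup (a : ι → ℝ) : ENNReal := ⨆ t, ENNReal.ofReal (Real.exp (a t))

theorem le_expSup (a : ι → ℝ) (t : ι) : ENNReal.ofReal (Real.exp (a t)) ≤ expSup a :=
  le_iSup (fun t => ENNReal.ofReal (Real.exp (a t))) t

@[fun_prop]
theorem measurable_expSup [Countable ι] {S : Type*} [MeasurableSpace S] {g : S → ι → ℝ}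
    (hg : Measurable g) : Measurable fun x => expSup (g x) :=
  Measurable.iSup fun t => by fun_prop

/-- Contraction: averaging over a random sign, the absolute value may be removed. -/
theorem expSup_add_abs_add_expSup_sub_abs_le [Nonempty ι] (a l : ι → ℝ) :
    expSup (fun t => a t + |l t|) + expSup (fun t => a t - |l t|) ≤
      expSup (fun t => a t + l t) + expSup (fun t => a t - l t) := by
  refine ENNReal.iSup_add_iSup_le fun t s => ?_
  have h1 := le_expSup (fun t => a t + l t)
  have h2 := le_expSup (fun t => a t - l t)
  -- Depending on the signs of `l t` and `l s`, the two exponentials are matched with the two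
  -- suprema; if the signs differ, the second one is first enlarged.
  beta_reduce
  rcases le_total 0 (l t) with ht | ht
  · rw [abs_of_nonneg ht]
    refine add_le_add (h1 t) (le_trans (ENNReal.ofReal_le_ofReal (Real.exp_le_exp.2 ?_)) (h2 s))
    linarith [le_abs_self (l s)]
  · rw [abs_of_nonpos ht, add_comm]
    refine add_le_add (le_trans (ENNReal.ofReal_le_ofReal (Real.exp_le_exp.2 ?_)) (h1 s))
      (by simpa only [sub_eq_add_neg] using h2 t)
    linarith [neg_abs_le (l s)]

theorem expSup_half_add_half_le (u v : ι → ℝ) :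
    expSup (fun t => (u t + v t) / 2) ≤ 2⁻¹ * (expSup u + expSup v) := by
  refine iSup_le fun t => ?_
  refine le_trans ?_ (mul_le_mul_right (add_le_add (le_expSup u t) (le_expSup v t)) _)
  rw [← ENNReal.ofReal_add (Real.exp_pos _).le (Real.exp_pos _).le,
    show (2⁻¹ : ENNReal) = ENNReal.ofReal 2⁻¹ by
      rw [ENNReal.ofReal_inv_of_pos (by norm_num)]; simp,
    ← ENNReal.ofReal_mul (by norm_num)]
  apply ENNReal.ofReal_le_ofReal
  have h := convexOn_exp.2 (Set.mem_univ (u t)) (Set.mem_univ (v t))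
    (show (0 : ℝ) ≤ 2⁻¹ by norm_num) (show (0 : ℝ) ≤ 2⁻¹ by norm_num) (by norm_num)
  simp only [smul_eq_mul] at h
  rw [mul_add]
  refine le_trans (le_of_eq ?_) h
  congr 1
  ring

/-- Jensen's inequality for the exponential of a supremum. -/
theorem expSup_integral_le_lintegral {S : Type*} [MeasurableSpace S] {μ : Measure S}
    [IsProbabilityMeasure μ] {f : ι → S → ℝ} (hf : ∀ t, Integrable (f t) μ) (a : ι → ℝ) :
    expSup (fun t => a t + ∫ x, f t x ∂μ) ≤ ∫⁻ x, expSup (fun t => a t + f t x) ∂μ := by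
  refine iSup_le fun t => ?_
  set M := ∫ x, f t x ∂μ with hM
  -- The tangent line of `exp` at `a t + M` may be negative, but `ofReal` only enlarges it.
  have hdev : Integrable (fun x => f t x - M) μ := (hf t).sub (integrable_const _)
  have hline : Integrable (fun x => Real.exp (a t + M) * (1 + (f t x - M))) μ :=
    ((integrable_const _).add hdev).const_mul _
  have hval : ∫ x, Real.exp (a t + M) * (1 + (f t x - M)) ∂μ = Real.exp (a t + M) := by
    rw [integral_const_mul,
      integral_add (integrable_const _) hdev,
      integral_sub (hf t) (integrable_const _)]
    simp [← hM]
  rw [← hval]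
  have hpos : ENNReal.ofReal (∫ x, Real.exp (a t + M) * (1 + (f t x - M)) ∂μ) ≤
      ∫⁻ x, ENNReal.ofReal (Real.exp (a t + M) * (1 + (f t x - M))) ∂μ := by
    rw [integral_eq_lintegral_pos_part_sub_lintegral_neg_part hline]
    exact (ENNReal.ofReal_le_ofReal (sub_le_self _ ENNReal.toReal_nonneg)).trans
      ENNReal.ofReal_toReal_le
  refine hpos.trans (lintegral_mono fun x => ?_)
  refine le_trans (ENNReal.ofReal_le_ofReal ?_) (le_expSup _ t)
  rw [show a t + f t x = (a t + M) + (f t x - M) by ring, Real.exp_add (a t + M)]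
  exact mul_le_mul_of_nonneg_left (by linarith [Real.add_one_le_exp (f t x - M)])
    (Real.exp_pos _).le

/-- The uniform distribution on the signs `±1`. -/
noncomputable def rademacher : Measure ℝ := (2⁻¹ : ENNReal) • (Measure.dirac 1 + Measure.dirac (-1))

instance : IsProbabilityMeasure rademacher := ⟨by
  simp only [rademacher, Measure.smul_apply, Measure.add_apply, measure_univ, smul_eq_mul]
  rw [one_add_one_eq_two, ENNReal.inv_mul_cancel (by simp) (by simp)]⟩

theorem lintegral_prod_rademacher {S : Type*} [MeasurableSpace S] {μ : Measure S} [SFinite μ]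
    {F : S × ℝ → ENNReal} (hF : Measurable F) :
    ∫⁻ p, F p ∂μ.prod rademacher = 2⁻¹ * (∫⁻ x, F (x, 1) ∂μ + ∫⁻ x, F (x, -1) ∂μ) := by
  rw [lintegral_prod _ hF.aemeasurable]
  simp only [rademacher, lintegral_smul_measure, lintegral_add_measure, smul_eq_mul]
  rw [lintegral_const_mul _ (by fun_prop), lintegral_add_left (by fun_prop)]
  congr 2 <;> exact lintegral_congr fun x => by
    rw [lintegral_dirac' _ (by fun_prop)]

/-- One-sided symmetrization and contraction for a single observation: the deviation of `|ℓ|` below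
its mean is dominated by twice the randomly signed `ℓ`. -/
theorem lintegral_expSup_sub_abs_le [Countable ι] [Nonempty ι] {S : Type*} [MeasurableSpace S]
    {μ : Measure S} [IsProbabilityMeasure μ] {l : ι → S → ℝ} (hl : ∀ t, Measurable (l t))
    (hint : ∀ t, Integrable (fun x => |l t x|) μ) (a : ι → ℝ) :
    ∫⁻ x, expSup (fun t => a t + (∫ y, |l t y| ∂μ - |l t x|)) ∂μ ≤
      ∫⁻ p, expSup (fun t => a t + 2 * p.2 * l t p.1) ∂μ.prod rademacher := by
  rw [lintegral_prod_rademacher (by fun_prop)]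
  calc ∫⁻ x, expSup (fun t => a t + (∫ y, |l t y| ∂μ - |l t x|)) ∂μ
      ≤ ∫⁻ x, 2⁻¹ * (expSup (fun t => a t + ∫ y, 2 * |l t y| ∂μ) +
          expSup (fun t => a t - |2 * l t x|)) ∂μ := by
        refine lintegral_mono fun x => ?_
        refine le_trans (le_of_eq ?_) (expSup_half_add_half_le _ _)
        congr 1
        funext t
        rw [integral_const_mul, abs_mul, abs_two]
        ring
    _ = 2⁻¹ * (expSup (fun t => a t + ∫ y, 2 * |l t y| ∂μ) +
          ∫⁻ x, expSup (fun t => a t - |2 * l t x|) ∂μ) := by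
        rw [lintegral_const_mul _ (by fun_prop), lintegral_add_left (by fun_prop), lintegral_const,
          measure_univ, mul_one]
    _ ≤ 2⁻¹ * (∫⁻ x, expSup (fun t => a t + |2 * l t x|) ∂μ +
          ∫⁻ x, expSup (fun t => a t - |2 * l t x|) ∂μ) := by
        gcongr
        refine (expSup_integral_le_lintegral (fun t => (hint t).const_mul 2) a).trans (le_of_eq ?_)
        simp_rw [abs_mul, abs_two]
    _ ≤ _ := by
        refine mul_le_mul_right ?_ _
        rw [← lintegral_add_left (by fun_prop), ← lintegral_add_left (by fun_prop)]
        refine lintegral_mono fun x => ?_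
        refine (expSup_add_abs_add_expSup_sub_abs_le a fun t => 2 * l t x).trans (le_of_eq ?_)
        simp [sub_eq_add_neg]

theorem lintegral_pi_succ {S : Type*} [MeasurableSpace S] {m : ℕ} (μ : Fin (m + 1) → Measure S)
    [∀ i, SigmaFinite (μ i)] {F : (Fin (m + 1) → S) → ENNReal} (hF : Measurable F) :
    ∫⁻ x, F x ∂Measure.pi μ =
      ∫⁻ x, ∫⁻ z, F (Fin.cons x z) ∂Measure.pi (fun i => μ i.succ) ∂μ 0 := by
  have h := (measurePreserving_piFinSuccAbove μ 0).symm
  rw [← h.lintegral_comp_emb (MeasurableEquiv.measurableEmbedding _), lintegral_prod]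
  · simp_rw [MeasurableEquiv.piFinSuccAbove_symm_apply, Fin.insertNthEquiv]
    simp
  · exact (hF.comp (MeasurableEquiv.measurable _)).aemeasurable

/-- Comparison inequalities that hold for single observations, with arbitrary offsets, hold for
sums of independent observations. -/
theorem lintegral_pi_expSup_le [Countable ι] {S T : Type*} [MeasurableSpace S] [MeasurableSpace T] :
    ∀ {m : ℕ} (μ : Fin m → Measure S) (ν : Fin m → Measure T) [∀ i, IsProbabilityMeasure (μ i)]
      [∀ i, IsProbabilityMeasure (ν i)] (g : Fin m → ι → S → ℝ) (h : Fin m → ι → T → ℝ),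
      (∀ i t, Measurable (g i t)) → (∀ i t, Measurable (h i t)) →
      (∀ i (a : ι → ℝ), ∫⁻ x, expSup (fun t => a t + g i t x) ∂μ i ≤
        ∫⁻ y, expSup (fun t => a t + h i t y) ∂ν i) →
      ∀ a : ι → ℝ, ∫⁻ x, expSup (fun t => a t + ∑ i, g i t (x i)) ∂Measure.pi μ ≤
        ∫⁻ y, expSup (fun t => a t + ∑ i, h i t (y i)) ∂Measure.pi ν
  | 0, μ, ν, _, _, g, h, _, _, _, a => by simp
  | m + 1, μ, ν, _, _, g, h, hg, hh, hgh, a => by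
    have IH := lintegral_pi_expSup_le (fun i => μ i.succ) (fun i => ν i.succ)
      (fun i => g i.succ) (fun i => h i.succ) (fun i => hg i.succ) (fun i => hh i.succ)
      (fun i => hgh i.succ)
    rw [lintegral_pi_succ μ (by fun_prop), lintegral_pi_succ ν (by fun_prop)]
    simp only [Fin.sum_univ_succ, Fin.cons_zero, Fin.cons_succ]
    calc ∫⁻ x, ∫⁻ z, expSup (fun t => a t + (g 0 t x + ∑ i : Fin m, g i.succ t (z i)))
            ∂Measure.pi (fun i : Fin m => μ i.succ) ∂μ 0
        ≤ ∫⁻ x, ∫⁻ z, expSup (fun t => a t + (g 0 t x + ∑ i : Fin m, h i.succ t (z i)))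
            ∂Measure.pi (fun i : Fin m => ν i.succ) ∂μ 0 := by
          refine lintegral_mono fun x => ?_
          simpa only [add_assoc] using IH fun t => a t + g 0 t x
      _ = ∫⁻ z, ∫⁻ x, expSup (fun t => a t + (g 0 t x + ∑ i : Fin m, h i.succ t (z i))) ∂μ 0
            ∂Measure.pi (fun i : Fin m => ν i.succ) :=
          lintegral_lintegral_swap (Measurable.aemeasurable (by
            unfold Function.uncurry; fun_prop))
      _ ≤ ∫⁻ z, ∫⁻ y, expSup (fun t => a t + (h 0 t y + ∑ i : Fin m, h i.succ t (z i))) ∂ν 0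
            ∂Measure.pi (fun i : Fin m => ν i.succ) := by
          refine lintegral_mono fun z => ?_
          have := hgh 0 fun t => a t + ∑ i : Fin m, h i.succ t (z i)
          simpa only [add_assoc, add_comm (∑ i : Fin m, h i.succ _ (z i))] using this
      _ = ∫⁻ y, ∫⁻ z, expSup (fun t => a t + (h 0 t y + ∑ i : Fin m, h i.succ t (z i)))
            ∂Measure.pi (fun i : Fin m => ν i.succ) ∂ν 0 :=
          lintegral_lintegral_swap (Measurable.aemeasurable (by
            unfold Function.uncurry; fun_prop))

end Symmetrization

/-! ### Nets on the sphere and signed sums of rank-one forms -/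

section Net

variable {n : ℕ}

/-- The complex unit sphere has a `1/2`-net of at most `25 ^ n` points: a maximal separated subset,
whose cardinality is bounded by comparing volumes. -/
theorem exists_half_net (n : ℕ) : ∃ N : Finset (EuclideanSpace ℂ (Fin n)), N.card ≤ 25 ^ n ∧
    (∀ w ∈ N, ‖w‖ = 1) ∧ ∀ v : EuclideanSpace ℂ (Fin n), ‖v‖ = 1 → ∃ w ∈ N, ‖v - w‖ ≤ 1 / 2 := by
  classical
  let p : ℕ → Prop := fun k => ∃ N : Finset (EuclideanSpace ℂ (Fin n)), N.card = k ∧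
    (∀ w ∈ N, ‖w‖ = 1) ∧ ∀ v ∈ N, ∀ w ∈ N, v ≠ w → 1 / 2 ≤ ‖v - w‖
  have hcard : ∀ k, p k → k ≤ 25 ^ n := by
    rintro k ⟨N, rfl, h1, h2⟩
    have hinj : Function.Injective fun w : EuclideanSpace ℂ (Fin n) => (2 : ℂ) • w :=
      smul_right_injective _ two_ne_zero
    have h := Besicovitch.card_le_of_separated (N.image fun w => (2 : ℂ) • w) ?_ ?_
    · rw [Finset.card_image_of_injective _ hinj, finrank_real_of_complex, finrank_euclideanSpace,
        Fintype.card_fin, pow_mul] at h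
      simpa using h
    · intro c hc
      obtain ⟨w, hw, rfl⟩ := Finset.mem_image.1 hc
      rw [norm_smul, h1 w hw]
      simp
    · intro c hc d hd hcd
      obtain ⟨v, hv, rfl⟩ := Finset.mem_image.1 hc
      obtain ⟨w, hw, rfl⟩ := Finset.mem_image.1 hd
      have := h2 v hv w hw fun h => hcd (by rw [h])
      rw [← smul_sub, norm_smul]
      norm_num
      linarith
  obtain ⟨N, hN, h1, h2⟩ : p (Nat.findGreatest p (25 ^ n)) :=
    Nat.findGreatest_spec (m := 0) (Nat.zero_le _) ⟨∅, by simp⟩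
  refine ⟨N, hcard _ ⟨N, rfl, h1, h2⟩, h1, fun v hv => ?_⟩
  by_contra! hfar
  have hvN : v ∉ N := fun h => by
    have := hfar v h
    rw [sub_self, norm_zero] at this
    norm_num at this
  have hp : p (N.card + 1) := by
    refine ⟨insert v N, Finset.card_insert_of_notMem hvN, ?_, ?_⟩
    · intro w hw
      rcases Finset.mem_insert.1 hw with rfl | hw
      exacts [hv, h1 w hw]
    · intro u hu w hw huw
      rcases Finset.mem_insert.1 hu with rfl | hu' <;>
        rcases Finset.mem_insert.1 hw with rfl | hw'
      · exact absurd rfl huw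
      · exact (hfar w hw').le
      · rw [norm_sub_rev]; exact (hfar u hu').le
      · exact h2 u hu' w hw' huw
  have := Nat.le_findGreatest (hcard _ hp) hp
  omega

/-- The Hermitian form `v ↦ ∑ εᵢ |⟨v, xᵢ⟩|²`. -/
noncomputable def signedForm {m : ℕ} (ε : Fin m → ℝ) (x : Fin m → EuclideanSpace ℂ (Fin n))
    (v : EuclideanSpace ℂ (Fin n)) : ℝ := ∑ i, ε i * ‖inner ℂ v (x i)‖ ^ 2

theorem signedForm_smul {m : ℕ} (ε : Fin m → ℝ) (x : Fin m → EuclideanSpace ℂ (Fin n))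
    (r : ℝ) (v : EuclideanSpace ℂ (Fin n)) :
    signedForm ε x ((r : ℂ) • v) = r ^ 2 * signedForm ε x v := by
  simp only [signedForm, Finset.mul_sum, inner_smul_left, norm_mul, RCLike.norm_conj,
    Complex.norm_real, Real.norm_eq_abs, mul_pow, sq_abs]
  exact Finset.sum_congr rfl fun i _ => by ring

/-- Polarization: with `d = v - w` and `s = v + w`, the difference of the values at `v` and `w` is
a quarter of the difference of the values at `2 d + s / 2` and `2 d - s / 2`. -/
theorem signedForm_sub_signedForm {m : ℕ} (ε : Fin m → ℝ) (x : Fin m → EuclideanSpace ℂ (Fin n))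
    (v w : EuclideanSpace ℂ (Fin n)) :
    signedForm ε x v - signedForm ε x w =
      (signedForm ε x ((5 / 2 : ℂ) • v - (3 / 2 : ℂ) • w) -
        signedForm ε x ((3 / 2 : ℂ) • v - (5 / 2 : ℂ) • w)) / 4 := by
  simp only [signedForm, ← Finset.sum_sub_distrib, Finset.sum_div]
  refine Finset.sum_congr rfl fun i _ => ?_
  simp only [inner_sub_left, inner_smul_left, ← Complex.normSq_eq_norm_sq, Complex.normSq_apply,
    map_div₀, Complex.conj_ofNat]
  simp only [Complex.sub_re, Complex.sub_im, Complex.mul_re, Complex.mul_im]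
  norm_num
  ring

/-- Up to a constant, a Hermitian form attains its maximal modulus over the sphere on a net. -/
theorem exists_abs_signedForm_le {m : ℕ} (hn : 0 < n) {N : Finset (EuclideanSpace ℂ (Fin n))}
    (hN1 : ∀ w ∈ N, ‖w‖ = 1)
    (hN : ∀ v : EuclideanSpace ℂ (Fin n), ‖v‖ = 1 → ∃ w ∈ N, ‖v - w‖ ≤ 1 / 2)
    (ε : Fin m → ℝ) (x : Fin m → EuclideanSpace ℂ (Fin n)) :
    ∃ w ∈ N, ∀ v, ‖v‖ = 1 → |signedForm ε x v| ≤ 32 * |signedForm ε x w| := by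
  have hcont : Continuous fun v => |signedForm ε x v| := by
    unfold signedForm; fun_prop
  have hne : (Metric.sphere (0 : EuclideanSpace ℂ (Fin n)) 1).Nonempty :=
    ⟨EuclideanSpace.single ⟨0, hn⟩ 1, by simp⟩
  obtain ⟨v, hv, hmax⟩ := (isCompact_sphere (0 : EuclideanSpace ℂ (Fin n)) 1).exists_isMaxOn hne
    hcont.continuousOn
  rw [mem_sphere_zero_iff_norm] at hv
  set r := |signedForm ε x v| with hr
  have hunit : ∀ u, ‖u‖ = 1 → |signedForm ε x u| ≤ r := fun u hu =>
    hmax (mem_sphere_zero_iff_norm.2 hu)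
  have hall : ∀ u, |signedForm ε x u| ≤ r * ‖u‖ ^ 2 := by
    intro u
    rcases eq_or_ne u 0 with rfl | hu
    · simp [signedForm]
    · have h0 : 0 < ‖u‖ := norm_pos_iff.2 hu
      have h1 := hunit (((‖u‖⁻¹ : ℝ) : ℂ) • u) (by
        rw [norm_smul, Complex.norm_real, norm_inv, norm_norm, inv_mul_cancel₀ h0.ne'])
      rw [signedForm_smul, abs_mul, abs_of_nonneg (sq_nonneg _), inv_pow,
        inv_mul_le_iff₀ (by positivity)] at h1
      linarith
  obtain ⟨w, hwN, hvw⟩ := hN v hv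
  have hw := hN1 w hwN
  refine ⟨w, hwN, fun u hu => (hunit u hu).trans ?_⟩
  have hd := signedForm_sub_signedForm ε x v w
  have h1 := hall ((5 / 2 : ℂ) • v - (3 / 2 : ℂ) • w)
  have h2 := hall ((3 / 2 : ℂ) • v - (5 / 2 : ℂ) • w)
  have h3 : ‖v - w‖ ^ 2 ≤ 1 / 4 := by nlinarith [norm_nonneg (v - w)]
  rw [@norm_sub_sq ℂ, hv, hw] at h3
  rw [@norm_sub_sq ℂ, norm_smul, norm_smul, hv, hw, inner_smul_left, inner_smul_right] at h1 h2
  simp only [map_div₀, Complex.conj_ofNat, RCLike.re_to_complex] at h1 h2 h3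
  rw [← mul_assoc] at h1 h2
  have hre : ∀ z : ℂ, (5 / 2 * (3 / 2) * z).re = 15 / 4 * z.re := fun z => by
    rw [show (5 / 2 * (3 / 2) : ℂ) = ((15 / 4 : ℝ) : ℂ) by push_cast; norm_num,
      Complex.re_ofReal_mul]
  rw [hre] at h1
  rw [mul_comm (3 / 2 : ℂ), hre] at h2
  norm_num at h1 h2
  have h4 := abs_le.1 h1
  have h5 := abs_le.1 h2
  have hr0 : 0 ≤ r := abs_nonneg _
  have h6 : |signedForm ε x v - signedForm ε x w| ≤ 31 / 32 * r := by
    rw [hd, abs_le]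
    constructor <;> nlinarith [h4.1, h4.2, h5.1, h5.2]
  have h7 := abs_sub_abs_le_abs_sub (signedForm ε x v) (signedForm ε x w)
  linarith

end Net

/-! ### Uniform deviation of the absolute measurements below their means -/

section Concentration

variable {n : ℕ}

/-- The quadratic form `x ↦ ∑ λₖ |⟨vₖ, x⟩|²` with coefficients `λ = p.1` and vectors `v = p.2`. -/
noncomputable def weightedForm (p : (Fin n → ℝ) × (Fin n → EuclideanSpace ℂ (Fin n)))
    (x : EuclideanSpace ℂ (Fin n)) : ℝ := ∑ k, p.1 k * ‖inner ℂ (p.2 k) x‖ ^ 2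

theorem measurable_weightedForm (p : (Fin n → ℝ) × (Fin n → EuclideanSpace ℂ (Fin n))) :
    Measurable (weightedForm p) := by
  unfold weightedForm; fun_prop

theorem continuous_weightedForm (x : EuclideanSpace ℂ (Fin n)) :
    Continuous fun p : (Fin n → ℝ) × (Fin n → EuclideanSpace ℂ (Fin n)) => weightedForm p x := by
  unfold weightedForm; fun_prop

theorem sum_mul_weightedForm_le {m : ℕ} {ε : Fin m → ℝ} {x : Fin m → EuclideanSpace ℂ (Fin n)}
    {M : ℝ} (hM : ∀ v, ‖v‖ = 1 → |signedForm ε x v| ≤ M)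
    {p : (Fin n → ℝ) × (Fin n → EuclideanSpace ℂ (Fin n))} (h1 : ∑ k, |p.1 k| ≤ 1)
    (h2 : ∀ k, ‖p.2 k‖ = 1) (hM0 : 0 ≤ M) : ∑ i, ε i * weightedForm p (x i) ≤ M := by
  have h : ∑ i, ε i * weightedForm p (x i) = ∑ k, p.1 k * signedForm ε x (p.2 k) := by
    simp only [weightedForm, signedForm, Finset.mul_sum]
    rw [Finset.sum_comm]
    exact Finset.sum_congr rfl fun k _ => Finset.sum_congr rfl fun i _ => by ring
  rw [h]
  calc ∑ k, p.1 k * signedForm ε x (p.2 k) ≤ ∑ k, |p.1 k| * M := by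
        refine Finset.sum_le_sum fun k _ => (le_abs_self _).trans ?_
        rw [abs_mul]
        exact mul_le_mul_of_nonneg_left (hM _ (h2 k)) (abs_nonneg _)
    _ ≤ M := by
        rw [← Finset.sum_mul]
        exact mul_le_of_le_one_left hM0 h1

theorem cosh_mul_le {θ : ℝ} (hθ : |θ| ≤ 1) (y : ℝ) :
    Real.cosh (θ * y) ≤ 1 + θ ^ 2 * (Real.cosh y - 1) := by
  have hθ2 : θ ^ 2 ≤ 1 := by rw [← sq_abs]; exact pow_le_one₀ (abs_nonneg _) hθ
  -- The power series are compared term by term.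
  have h1 := ((Real.hasSum_cosh y).mul_left (θ ^ 2)).add (hasSum_ite_eq 0 (1 - θ ^ 2))
  have h2 := hasSum_le (fun k => ?_) (Real.hasSum_cosh (θ * y)) h1
  · linarith
  · rcases Nat.eq_zero_or_pos k with rfl | hk
    · simp
    · rw [if_neg hk.ne', add_zero, mul_pow, mul_div_assoc, pow_mul θ]
      refine mul_le_mul_of_nonneg_right ?_ (div_nonneg (pow_mul y 2 k ▸ by positivity)
        (Nat.cast_nonneg _))
      exact pow_le_of_le_one (sq_nonneg _) hθ2 hk.ne'

theorem lintegral_exp_sign_mul_le {S : Type*} [MeasurableSpace S] {μ : Measure S}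
    [IsProbabilityMeasure μ] {W : S → ℝ} (hW : Measurable W) (hW0 : ∀ x, 0 ≤ W x) {c s : ℝ}
    (hc : 0 < c) (hs : |s| * c ≤ 1)
    (hexp : ∫⁻ x, ENNReal.ofReal (Real.exp (W x / c)) ∂μ ≤ 2) :
    ∫⁻ p, ENNReal.ofReal (Real.exp (s * p.2 * W p.1)) ∂μ.prod rademacher ≤
      ENNReal.ofReal (Real.exp ((s * c) ^ 2)) := by
  obtain ⟨h1, h2⟩ := integrable_and_integral_le_of_lintegral_ofReal_le (C := 2)
    (f := fun x => Real.exp (W x / c)) (by fun_prop) (fun x => (Real.exp_pos _).le) (by norm_num)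
    (by simpa using hexp)
  have hθ : |s * c| ≤ 1 := by rwa [abs_mul, abs_of_pos hc]
  rw [lintegral_prod_rademacher (by fun_prop), ← lintegral_add_left (by fun_prop),
    ← lintegral_const_mul _ (by fun_prop)]
  have hi : Integrable (fun x => (s * c) ^ 2 * (Real.exp (W x / c) - 1)) μ :=
    (h1.sub (integrable_const _)).const_mul _
  have hone : ∀ x, 1 ≤ Real.exp (W x / c) := fun x =>
    Real.one_le_exp (div_nonneg (hW0 x) hc.le)
  calc ∫⁻ x, 2⁻¹ * (ENNReal.ofReal (Real.exp (s * 1 * W x)) +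
          ENNReal.ofReal (Real.exp (s * -1 * W x))) ∂μ
      ≤ ∫⁻ x, ENNReal.ofReal (1 + (s * c) ^ 2 * (Real.exp (W x / c) - 1)) ∂μ := by
        refine lintegral_mono fun x => ?_
        rw [← ENNReal.ofReal_add (Real.exp_pos _).le (Real.exp_pos _).le,
          show (2⁻¹ : ENNReal) = ENNReal.ofReal 2⁻¹ by
            rw [ENNReal.ofReal_inv_of_pos (by norm_num)]; simp,
          ← ENNReal.ofReal_mul (by norm_num)]
        apply ENNReal.ofReal_le_ofReal
        have h3 := cosh_mul_le hθ (W x / c)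
        have h4 : s * c * (W x / c) = s * W x := by field_simp
        have h5 : Real.cosh (W x / c) ≤ Real.exp (W x / c) := by
          rw [Real.cosh_eq]
          have : Real.exp (-(W x / c)) ≤ Real.exp (W x / c) :=
            Real.exp_le_exp.2 (by linarith [div_nonneg (hW0 x) hc.le])
          linarith
        rw [h4, Real.cosh_eq] at h3
        have h6 := mul_le_mul_of_nonneg_left h5 (sq_nonneg (s * c))
        rw [mul_one, show s * -1 * W x = -(s * W x) by ring]
        linarith
    _ = ENNReal.ofReal (∫ x, (1 + (s * c) ^ 2 * (Real.exp (W x / c) - 1)) ∂μ) := by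
        have hi' : Integrable (fun x => 1 + (s * c) ^ 2 * (Real.exp (W x / c) - 1)) μ :=
          (integrable_const _).add hi
        rw [ofReal_integral_eq_lintegral_ofReal hi' (ae_of_all _ fun x =>
          add_nonneg zero_le_one (mul_nonneg (sq_nonneg _) (sub_nonneg.2 (hone x))))]
    _ ≤ _ := by
        apply ENNReal.ofReal_le_ofReal
        rw [integral_add (integrable_const _) hi, integral_const_mul,
          integral_sub h1 (integrable_const _)]
        simp only [integral_const, probReal_univ, smul_eq_mul, mul_one]
        nlinarith [Real.add_one_le_exp ((s * c) ^ 2), sq_nonneg (s * c)]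

theorem lintegral_pi_exp_sum_le {S : Type*} [MeasurableSpace S] {m : ℕ} {ν : Fin m → Measure S}
    [∀ i, IsProbabilityMeasure (ν i)] {f : S → ℝ} (hf : Measurable f) {C : ENNReal}
    (h : ∀ i, ∫⁻ y, ENNReal.ofReal (Real.exp (f y)) ∂ν i ≤ C) :
    ∫⁻ y, ENNReal.ofReal (Real.exp (∑ i, f (y i))) ∂Measure.pi ν ≤ C ^ m := by
  simp_rw [Real.exp_sum, ENNReal.ofReal_prod_of_nonneg fun i _ => (Real.exp_pos (f _)).le]
  rw [lintegral_prod_eq_prod_lintegral_of_indepFun Finset.univ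
    (fun i (y : Fin m → S) => ENNReal.ofReal (Real.exp (f (y i))))
    (iIndepFun_pi (X := fun _ z => ENNReal.ofReal (Real.exp (f z)))
      fun i => Measurable.aemeasurable (by fun_prop)) (fun i => by fun_prop)]
  calc ∏ i, ∫⁻ y, ENNReal.ofReal (Real.exp (f (y i))) ∂Measure.pi ν
      ≤ ∏ _i : Fin m, C := Finset.prod_le_prod' fun i _ => by
        rw [(measurePreserving_eval ν i).lintegral_comp
          (f := fun z => ENNReal.ofReal (Real.exp (f z))) (by fun_prop)]
        exact h i
    _ = C ^ m := by simp

end Concentration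

section UniformLowerBound

variable {n : ℕ} {Ω : Type*} [MeasurableSpace Ω] {P : Measure Ω} [IsProbabilityMeasure P]

/-- The exponential moment of the largest one-sided deviation over a countable family. After
symmetrization and contraction the supremum is at most a multiple of the largest signed form on a
net, and the exponential moments at each point of the net factor over the observations. -/
theorem lintegral_expSup_deviation_le {m : ℕ} (hn : 0 < n)
    {ξ : Fin m → Ω → EuclideanSpace ℂ (Fin n)} (hξ : ∀ i, Measurable (ξ i)) (hind : iIndepFun ξ P)
    {c s : ℝ} (hc : 0 < c) (hs : 0 ≤ s) (hsc : 64 * s * c ≤ 1)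
    (hexp : ∀ i v, ‖v‖ ≤ 1 →
      ∫⁻ ω, ENNReal.ofReal (Real.exp (‖inner ℂ v (ξ i ω)‖ ^ 2 / c)) ∂P ≤ 2)
    {ι : Type*} [Countable ι] [Nonempty ι]
    (p : ι → (Fin n → ℝ) × (Fin n → EuclideanSpace ℂ (Fin n)))
    (h1 : ∀ t, ∑ k, |(p t).1 k| ≤ 1) (h2 : ∀ t k, ‖(p t).2 k‖ = 1)
    (hint : ∀ t i, Integrable (fun ω => |weightedForm (p t) (ξ i ω)|) P) :
    ∫⁻ ω, expSup (fun t => ∑ i, (∫ ω', |s * weightedForm (p t) (ξ i ω')| ∂P -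
        |s * weightedForm (p t) (ξ i ω)|)) ∂P ≤
      ENNReal.ofReal (2 * 25 ^ n * Real.exp (m * (64 * s * c) ^ 2)) := by
  obtain ⟨N, hNcard, hN1, hN⟩ := exists_half_net n
  have hmeas := fun t => measurable_weightedForm (p t)
  have hprob : ∀ i, IsProbabilityMeasure (P.map (ξ i)) := fun i =>
    Measure.isProbabilityMeasure_map (hξ i).aemeasurable
  have hmean : ∀ i t, ∫ x, |s * weightedForm (p t) x| ∂P.map (ξ i) =
      ∫ ω, |s * weightedForm (p t) (ξ i ω)| ∂P := fun i t =>
    integral_map (hξ i).aemeasurable (by fun_prop)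
  have hint' : ∀ i t, Integrable (fun x => |s * weightedForm (p t) x|) (P.map (ξ i)) := by
    intro i t
    rw [integrable_map_measure (by fun_prop) (hξ i).aemeasurable]
    simpa only [Function.comp_def, abs_mul] using (hint t i).const_mul |s|
  have hsymm := lintegral_pi_expSup_le (fun i => P.map (ξ i))
    (fun i => (P.map (ξ i)).prod rademacher)
    (fun i t x => ∫ y, |s * weightedForm (p t) y| ∂P.map (ξ i) - |s * weightedForm (p t) x|)
    (fun _ t y => 2 * y.2 * (s * weightedForm (p t) y.1)) (fun i t => by fun_prop)
    (fun i t => by fun_prop)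
    (fun i a => lintegral_expSup_sub_abs_le (fun t => by fun_prop) (hint' i) a) 0
  simp only [Pi.zero_apply, zero_add, hmean] at hsymm
  rw [← (iIndepFun_iff_map_fun_eq_pi_map fun i => (hξ i).aemeasurable).1 hind,
    lintegral_map (by fun_prop) (by fun_prop)] at hsymm
  refine hsymm.trans ?_
  set ν : Fin m → Measure (EuclideanSpace ℂ (Fin n) × ℝ) :=
    fun i => (P.map (ξ i)).prod rademacher with hν
  have hpt : ∀ y : Fin m → EuclideanSpace ℂ (Fin n) × ℝ,
      expSup (fun t => ∑ i, 2 * (y i).2 * (s * weightedForm (p t) (y i).1)) ≤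
      ∑ w ∈ N,
        (ENNReal.ofReal (Real.exp (∑ i, 64 * s * (y i).2 * ‖inner ℂ w (y i).1‖ ^ 2)) +
        ENNReal.ofReal (Real.exp (∑ i, -(64 * s) * (y i).2 * ‖inner ℂ w (y i).1‖ ^ 2))) := by
    intro y
    obtain ⟨w, hwN, hw⟩ := exists_abs_signedForm_le hn hN1 hN
      (fun i => (y i).2) (fun i => (y i).1)
    refine le_trans ?_ (Finset.single_le_sum (fun _ _ => zero_le) hwN)
    refine iSup_le fun t => ?_
    have h3 := sum_mul_weightedForm_le hw (h1 t) (h2 t) (by positivity)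
    have h4 : ∑ i, 2 * (y i).2 * (s * weightedForm (p t) (y i).1) =
        2 * s * ∑ i, (y i).2 * weightedForm (p t) (y i).1 := by
      rw [Finset.mul_sum]
      exact Finset.sum_congr rfl fun i _ => by ring
    have h5 : ∀ r : ℝ, ∑ i, r * (y i).2 * ‖inner ℂ w (y i).1‖ ^ 2 =
        r * signedForm (fun i => (y i).2) (fun i => (y i).1) w := fun r => by
      rw [signedForm, Finset.mul_sum]
      exact Finset.sum_congr rfl fun i _ => by ring
    beta_reduce
    rw [h4, h5, h5]
    set Q := signedForm (fun i => (y i).2) (fun i => (y i).1) w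
    have h6 := mul_le_mul_of_nonneg_left h3 (show 0 ≤ 2 * s by linarith)
    rcases abs_cases Q with ⟨hQ, _⟩ | ⟨hQ, _⟩
    · refine le_trans (ENNReal.ofReal_le_ofReal (Real.exp_le_exp.2 ?_)) le_self_add
      rw [hQ] at h6; linarith
    · refine le_trans (ENNReal.ofReal_le_ofReal (Real.exp_le_exp.2 ?_)) le_add_self
      rw [hQ] at h6; linarith
  have hfac : ∀ w : EuclideanSpace ℂ (Fin n), ‖w‖ ≤ 1 → ∀ r : ℝ, |r| = 64 * s →
      ∫⁻ y, ENNReal.ofReal (Real.exp (∑ i, r * (y i).2 * ‖inner ℂ w (y i).1‖ ^ 2)) ∂Measure.pi ν ≤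
        ENNReal.ofReal (Real.exp ((64 * s * c) ^ 2)) ^ m := by
    intro w hw r hr
    refine lintegral_pi_exp_sum_le (ν := ν)
      (f := fun z : EuclideanSpace ℂ (Fin n) × ℝ => r * z.2 * ‖inner ℂ w z.1‖ ^ 2)
      (by fun_prop) fun i => ?_
    refine (lintegral_exp_sign_mul_le (W := fun x => ‖inner ℂ w x‖ ^ 2) (by fun_prop)
      (fun x => by positivity) hc (by rw [hr]; exact hsc) ?_).trans (le_of_eq ?_)
    · rw [lintegral_map (by fun_prop) (hξ i)]
      exact hexp i w hw
    · rw [mul_pow, mul_pow _ c, ← sq_abs r, hr]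
  refine (lintegral_mono hpt).trans ?_
  rw [lintegral_finsetSum _ fun w _ => by fun_prop]
  have habs : |64 * s| = 64 * s := abs_of_nonneg (by linarith)
  calc ∑ w ∈ N, ∫⁻ y,
        (ENNReal.ofReal (Real.exp (∑ i, 64 * s * (y i).2 * ‖inner ℂ w (y i).1‖ ^ 2)) +
        ENNReal.ofReal (Real.exp (∑ i, -(64 * s) * (y i).2 * ‖inner ℂ w (y i).1‖ ^ 2)))
          ∂Measure.pi ν
      ≤ ∑ w ∈ N,
          2 * ENNReal.ofReal (Real.exp ((64 * s * c) ^ 2)) ^ m := by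
        refine Finset.sum_le_sum fun w hw => ?_
        rw [lintegral_add_left (by fun_prop), two_mul]
        have hw1 := (hN1 w hw).le
        exact add_le_add (hfac w hw1 _ habs) (hfac w hw1 _ (by rw [abs_neg, habs]))
    _ ≤ (25 ^ n : ℕ) * (2 * ENNReal.ofReal (Real.exp ((64 * s * c) ^ 2)) ^ m) := by
        rw [Finset.sum_const, nsmul_eq_mul]
        gcongr
    _ = ENNReal.ofReal (2 * 25 ^ n * Real.exp (m * (64 * s * c) ^ 2)) := by
        rw [← ENNReal.ofReal_pow (Real.exp_pos _).le, ← Real.exp_nat_mul,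
          ENNReal.ofReal_mul (by positivity), ENNReal.ofReal_mul (by norm_num),
          ENNReal.ofReal_pow (by norm_num)]
        push_cast
        simp only [ENNReal.ofReal_ofNat]
        ring

/-- With high probability all quadratic forms in a normalized family whose first absolute moments
are at least `2 δ` have absolute measurements averaging at least `δ`. -/
theorem exists_measurableSet_forall_le_sum_abs_weightedForm {m : ℕ} (hn : 0 < n)
    {ξ : Fin m → Ω → EuclideanSpace ℂ (Fin n)} (hξ : ∀ i, Measurable (ξ i)) (hind : iIndepFun ξ P)
    {c δ : ℝ} (hc : 0 < c) (hδ : 0 < δ) (hδc : δ ≤ 128 * c)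
    (hexp : ∀ i v, ‖v‖ ≤ 1 →
      ∫⁻ ω, ENNReal.ofReal (Real.exp (‖inner ℂ v (ξ i ω)‖ ^ 2 / c)) ∂P ≤ 2)
    (T : Set ((Fin n → ℝ) × (Fin n → EuclideanSpace ℂ (Fin n))))
    (hT : ∀ p ∈ T, ∑ k, |p.1 k| ≤ 1 ∧ (∀ k, ‖p.2 k‖ = 1) ∧
      ∀ i, 2 * δ ≤ ∫ ω, |weightedForm p (ξ i ω)| ∂P) :
    ∃ E : Set Ω, MeasurableSet E ∧
      1 - 2 * 25 ^ n * Real.exp (-(m * δ ^ 2 / (16384 * c ^ 2))) ≤ P.real E ∧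
      ∀ ω ∈ E, ∀ p ∈ T, m * δ ≤ ∑ i, |weightedForm p (ξ i ω)| := by
  -- By continuity it suffices to control a countable dense subfamily.
  obtain ⟨D, hDT, hDc, hTD⟩ :=
    (TopologicalSpace.IsSeparable.of_separableSpace T).exists_countable_dense_subset
  have hform := fun p => measurable_weightedForm (n := n) p
  let E : Set Ω := ⋂ p ∈ D, {ω | m * δ ≤ ∑ i, |weightedForm p (ξ i ω)|}
  have hE : MeasurableSet E := MeasurableSet.biInter hDc fun p _ =>
    measurableSet_le measurable_const (by fun_prop)
  refine ⟨E, hE, ?_, fun ω hω p hp => ?_⟩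
  · rcases D.eq_empty_or_nonempty with rfl | hDne
    · have hEuniv : E = Set.univ := by simp [E]
      rw [hEuniv, probReal_univ]
      have : 0 ≤ 2 * 25 ^ n * Real.exp (-(m * δ ^ 2 / (16384 * c ^ 2))) := by positivity
      linarith
    · have : Countable D := hDc.to_subtype
      have : Nonempty D := hDne.to_subtype
      have hint : ∀ (t : D) i, Integrable (fun ω => |weightedForm t.1 (ξ i ω)|) P := fun t i =>
        Integrable.of_integral_ne_zero (by linarith [(hT t.1 (hDT t.2)).2.2 i] :
          (0 : ℝ) < ∫ ω, |weightedForm t.1 (ξ i ω)| ∂P).ne'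
      -- The exponent that balances the linear gain `s m δ` against the quadratic loss.
      set s := δ / (8192 * c ^ 2) with hs
      have hs0 : 0 < s := by positivity
      have hsc : 64 * s * c = δ / (128 * c) := by rw [hs]; field_simp; norm_num
      have hdev := lintegral_expSup_deviation_le hn hξ hind hc hs0.le
        (by rw [hsc, div_le_one (by positivity)]; exact hδc) hexp (fun t : D => t.1)
        (fun t => (hT t.1 (hDT t.2)).1) (fun t => (hT t.1 (hDT t.2)).2.1) hint
      have hbad : Eᶜ ⊆ {ω | ENNReal.ofReal (Real.exp (s * (m * δ))) ≤
          expSup (fun t : D => ∑ i, (∫ ω', |s * weightedForm t.1 (ξ i ω')| ∂P -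
            |s * weightedForm t.1 (ξ i ω)|))} := by
        intro ω hω
        simp only [E, Set.mem_compl_iff, Set.mem_iInter, Set.mem_ofPred_eq, not_forall,
          not_le] at hω
        obtain ⟨p, hp, hlt⟩ := hω
        refine le_trans (ENNReal.ofReal_le_ofReal (Real.exp_le_exp.2 ?_))
          (le_expSup _ (⟨p, hp⟩ : D))
        simp only [abs_mul, abs_of_pos hs0, integral_const_mul, ← mul_sub, ← Finset.mul_sum]
        refine mul_le_mul_of_nonneg_left ?_ hs0.le
        rw [Finset.sum_sub_distrib]
        have h1 : ∑ _i : Fin m, 2 * δ ≤ ∑ i, ∫ ω', |weightedForm p (ξ i ω')| ∂P :=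
          Finset.sum_le_sum fun i _ => (hT p (hDT hp)).2.2 i
        rw [Finset.sum_const, Finset.card_univ, Fintype.card_fin, nsmul_eq_mul] at h1
        linarith
      have hmarkov := (mul_meas_ge_le_lintegral (μ := P)
        (f := fun ω => expSup (fun t : D => ∑ i, (∫ ω', |s * weightedForm t.1 (ξ i ω')| ∂P -
            |s * weightedForm t.1 (ξ i ω)|))) (by fun_prop)
        (ENNReal.ofReal (Real.exp (s * (m * δ))))).trans hdev
      have hmeas : P.real Eᶜ ≤ 2 * 25 ^ n * Real.exp (-(m * δ ^ 2 / (16384 * c ^ 2))) := by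
        have h1 := (mul_le_mul_right (measure_mono (μ := P) hbad)
          (ENNReal.ofReal (Real.exp (s * (m * δ))))).trans hmarkov
        rw [← ofReal_measureReal, ← ENNReal.ofReal_mul (Real.exp_pos _).le,
          ENNReal.ofReal_le_ofReal_iff (by positivity), mul_comm,
          ← le_div_iff₀ (Real.exp_pos _), mul_div_assoc, ← Real.exp_sub] at h1
        refine h1.trans (le_of_eq ?_)
        congr 2
        rw [hsc, hs]
        field_simp
        ring
      have := probReal_add_probReal_compl (μ := P) hE
      linarith
  · have hclosed : IsClosed {p : (Fin n → ℝ) × (Fin n → EuclideanSpace ℂ (Fin n)) |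
        m * δ ≤ ∑ i, |weightedForm p (ξ i ω)|} :=
      isClosed_le continuous_const
        (continuous_finsetSum _ fun i _ => (continuous_weightedForm (ξ i ω)).abs)
    refine closure_minimal (fun q hq => ?_) hclosed (hTD hp)
    exact Set.mem_iInter₂.1 hω q hq

end UniformLowerBound

/-! ### Uniform recovery -/

section Recovery

variable {n m : ℕ} {Ω : Type*} [MeasurableSpace Ω] {P : Measure Ω} [IsProbabilityMeasure P]

namespace IsSubgaussianEnsemble

variable {ξ : Fin m → Ω → EuclideanSpace ℂ (Fin n)} {K β : ℝ}

theorem one_le (h : IsSubgaussianEnsemble P ξ K) (i : Fin m) (j : Fin n) : 1 ≤ K :=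
  one_le_of_isSubgaussian (h.variance_one i j) (h.subgaussian i j)

theorem le_integral_sq (h : IsSubgaussianEnsemble P ξ K) (i : Fin m) (j : Fin n) (Z : Herm n) :
    realTrace Z ^ 2 + ((∫ ω, ‖ξ i ω j‖ ^ 4 ∂P) - 1) * diagEnergy Z +
      (1 - ‖∫ ω, ξ i ω j ^ 2 ∂P‖ ^ 2) * offDiagEnergy Z ≤
      ∫ ω, hsInner (rankOne (ξ i ω)) Z ^ 2 ∂P := by
  have hK : 0 < K := one_pos.trans_le (h.one_le i j)
  have hξ := h.measurable i
  refine le_integral_hsInner_rankOne_sq hξ (h.indep_entries i) (h.mean_zero i)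
    (h.variance_one i) (fun k => ?_) (fun k => ?_)
    (fun k => integrable_norm_pow_four_of_isSubgaussian (by fun_prop) hK (h.subgaussian i k)) Z
  · exact ((h.identDistrib i i k j).comp (u := fun z : ℂ => z ^ 2) (by fun_prop)).integral_eq
  · exact ((h.identDistrib i i k j).comp (u := fun z : ℂ => ‖z‖ ^ 4) (by fun_prop)).integral_eq

theorem one_le_integral_norm_pow_four (h : IsSubgaussianEnsemble P ξ K) (i : Fin m) (j : Fin n) :
    1 ≤ ∫ ω, ‖ξ i ω j‖ ^ 4 ∂P := by
  have hK : 0 < K := one_pos.trans_le (h.one_le i j)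
  have hξ := h.measurable i
  have h4 : Integrable (fun ω => ‖ξ i ω j‖ ^ 4) P :=
    integrable_norm_pow_four_of_isSubgaussian (by fun_prop) hK (h.subgaussian i j)
  have h2 : Integrable (fun ω => ‖ξ i ω j‖ ^ 2) P :=
    integrable_of_integral_eq_one (h.variance_one i j)
  have hmono := integral_mono ((h2.const_mul 2).sub (integrable_const 1)) h4 fun ω => by
    simp only [Pi.sub_apply]
    nlinarith [sq_nonneg (‖ξ i ω j‖ ^ 2 - 1)]
  simp only [Pi.sub_apply] at hmono
  rw [integral_sub (h2.const_mul 2) (integrable_const 1), integral_const_mul,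
    h.variance_one] at hmono
  norm_num at hmono
  exact hmono

/-- The second moments of the measurements are bounded below on error matrices of signals with
small peak. -/
theorem schattenOne_sq_le_integral_of_mem_boundedPeakSignals (h : IsSubgaussianEnsemble P ξ K)
    (hβ0 : 0 < β) (hβ1 : β < 1) (hσ : ∀ i j, ‖∫ ω, (ξ i ω j) ^ 2 ∂P‖ ^ 2 ≤ 1 - β) (hn : 0 < n)
    {x₀ : EuclideanSpace ℂ (Fin n)} (hx₀ : x₀ ∈ boundedPeakSignals n (1 / 81)) {X : Herm n}
    (hX : X ∈ psdCone n) (i : Fin m) :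
    β / 20 * schattenOne (X - rankOne x₀) ^ 2 ≤
      ∫ ω, hsInner (rankOne (ξ i ω)) (X - rankOne x₀) ^ 2 ∂P := by
  have h1 := h.le_integral_sq i ⟨0, hn⟩ (X - rankOne x₀)
  have h2 := schattenOne_sq_le_of_mem_boundedPeakSignals hX hx₀
  have h3 := mul_nonneg (sub_nonneg.2 (h.one_le_integral_norm_pow_four i ⟨0, hn⟩))
    (diagEnergy_nonneg (X - rankOne x₀))
  have h4 := mul_le_mul_of_nonneg_right (le_sub_comm.1 (hσ i ⟨0, hn⟩))
    (offDiagEnergy_nonneg (X - rankOne x₀))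
  nlinarith [sq_nonneg (realTrace (X - rankOne x₀))]

/-- If the fourth moment of the entries exceeds one, the second moments of the measurements are
bounded below on all error matrices. -/
theorem schattenOne_sq_le_integral_of_ne_zero (h : IsSubgaussianEnsemble P ξ K)
    (hβ0 : 0 < β) (hβ1 : β < 1) (hσ : ∀ i j, ‖∫ ω, (ξ i ω j) ^ 2 ∂P‖ ^ 2 ≤ 1 - β)
    (hκ : ∀ i j, 1 + β ≤ ∫ ω, ‖ξ i ω j‖ ^ 4 ∂P) (hn : 0 < n)
    {x₀ : EuclideanSpace ℂ (Fin n)} (hx₀ : x₀ ≠ 0) {X : Herm n} (hX : X ∈ psdCone n) (i : Fin m) :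
    β / 20 * schattenOne (X - rankOne x₀) ^ 2 ≤
      ∫ ω, hsInner (rankOne (ξ i ω)) (X - rankOne x₀) ^ 2 ∂P := by
  have h1 := h.le_integral_sq i ⟨0, hn⟩ (X - rankOne x₀)
  have h2 := schattenOne_sq_le_of_ne_zero hX hx₀
  have h3 := mul_le_mul_of_nonneg_right (le_sub_iff_add_le'.2 (hκ i ⟨0, hn⟩))
    (diagEnergy_nonneg (X - rankOne x₀))
  have h4 := mul_le_mul_of_nonneg_right (le_sub_comm.1 (hσ i ⟨0, hn⟩))
    (offDiagEnergy_nonneg (X - rankOne x₀))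
  nlinarith [sq_nonneg (realTrace (X - rankOne x₀))]

end IsSubgaussianEnsemble

theorem l1Norm_nonneg (w : Fin m → ℝ) : 0 ≤ l1Norm w := Finset.sum_nonneg fun _ _ => abs_nonneg _

theorem UniformRecovery.mono {v : Fin m → EuclideanSpace ℂ (Fin n)}
    {S : Set (EuclideanSpace ℂ (Fin n))} {c c' : ℝ} (h : UniformRecovery v S c) (hc : c ≤ c') :
    UniformRecovery v S c' := fun x₀ hx₀ w X hX =>
  (h x₀ hx₀ w X hX).trans (mul_le_mul_of_nonneg_right hc (l1Norm_nonneg w))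

/-- A lower bound `b⁴ / 20` for the second moments of normalized error matrices implies uniform
recovery, at the scale `δ = b⁵ / (655360 K³)` of the resulting first absolute moments. -/
theorem IsSubgaussianEnsemble.exists_uniformRecovery
    {ξ : Fin m → Ω → EuclideanSpace ℂ (Fin n)} {K b : ℝ} (h : IsSubgaussianEnsemble P ξ K)
    (hn : 0 < n) (hm : 0 < m) (hb0 : 0 < b) (hb1 : b ≤ 1)
    (S : Set (EuclideanSpace ℂ (Fin n)))
    (hS : ∀ x₀ ∈ S, ∀ X ∈ psdCone n, ∀ i, b ^ 4 / 20 * schattenOne (X - rankOne x₀) ^ 2 ≤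
      ∫ ω, hsInner (rankOne (ξ i ω)) (X - rankOne x₀) ^ 2 ∂P) :
    ∃ E : Set Ω, MeasurableSet E ∧
      1 - 2 * 25 ^ n * Real.exp (-(m * (b ^ 10 / (25 * 2 ^ 60 * K ^ 10)))) ≤ P.real E ∧
      ∀ ω ∈ E, UniformRecovery (fun i => ξ i ω) S (1310720 * (K ^ 3 / (m * b ^ 5))) := by
  have hK1 : 1 ≤ K := h.one_le ⟨0, hm⟩ ⟨0, hn⟩
  have hK : 0 < K := by linarith
  have hm' : (0 : ℝ) < m := Nat.cast_pos.2 hm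
  have hexp : ∀ i v, ‖v‖ ≤ 1 →
      ∫⁻ ω, ENNReal.ofReal (Real.exp (‖inner ℂ v (ξ i ω)‖ ^ 2 / (64 * K ^ 2))) ∂P ≤ 2 :=
    fun i v hv => lintegral_exp_norm_inner_sq_le hK (h.measurable i) (h.indep_entries i)
      (h.mean_zero i) (h.subgaussian i) v hv
  set δ := b ^ 5 / (655360 * K ^ 3) with hδ
  have hδ0 : 0 < δ := by positivity
  have hδc : δ ≤ 128 * (64 * K ^ 2) := by
    have h1 : δ ≤ 1 := by
      rw [hδ, div_le_one (by positivity)]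
      have := pow_le_one₀ hb0.le hb1 (n := 5)
      have := one_le_pow₀ hK1 (n := 3)
      linarith
    have := one_le_pow₀ hK1 (n := 2)
    linarith
  -- Error matrices are normalized to Schatten-1 norm one and described by their eigenvalues and
  -- eigenvectors.
  let normalized : Herm n → (Fin n → ℝ) × (Fin n → EuclideanSpace ℂ (Fin n)) := fun Z =>
    (fun k => Z.isHermitian.eigenvalues k / schattenOne Z, Z.isHermitian.eigenvectorBasis)
  have hform : ∀ Z x, weightedForm (normalized Z) x = hsInner (rankOne x) Z / schattenOne Z := by
    intro Z x
    rw [hsInner_rankOne_eq_sum_eigenvalues, weightedForm, Finset.sum_div]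
    exact Finset.sum_congr rfl fun k _ => div_mul_eq_mul_div _ _ _
  obtain ⟨E, hE, hPE, hgood⟩ := exists_measurableSet_forall_le_sum_abs_weightedForm hn
    h.measurable h.indep_vectors (c := 64 * K ^ 2) (by positivity) hδ0 hδc hexp
    {p | ∃ x₀ ∈ S, ∃ X ∈ psdCone n, 0 < schattenOne (X - rankOne x₀) ∧
      p = normalized (X - rankOne x₀)} (by
      rintro p ⟨x₀, hx₀, X, hX, hpos, rfl⟩
      refine ⟨?_, fun k => OrthonormalBasis.norm_eq_one _ k, fun i => ?_⟩
      · simp only [normalized, abs_div, abs_of_pos hpos]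
        rw [← Finset.sum_div]
        exact (div_self hpos.ne').le
      · have h1 := le_integral_abs_hsInner (h.measurable i) hK hb0 (hexp i) _ hpos
          (hS x₀ hx₀ X hX i)
        simp only [hform, abs_div, abs_of_pos hpos]
        rw [integral_div, le_div_iff₀ hpos]
        refine le_trans (le_of_eq ?_) h1
        rw [hδ]
        field_simp
        norm_num)
  refine ⟨E, hE, le_trans (le_of_eq ?_) hPE, fun ω hω x₀ hx₀ w X hX => ?_⟩
  · rw [hδ]
    congr 4
    field_simp
    norm_num
  · rcases (schattenOne_nonneg (X - rankOne x₀)).eq_or_lt with h0 | hpos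
    · rw [← h0]
      exact mul_nonneg (by positivity) (l1Norm_nonneg w)
    · have h1 := hgood ω hω _ ⟨x₀, hx₀, X, hX.1, hpos, rfl⟩
      simp only [hform, abs_div, abs_of_pos hpos] at h1
      rw [← Finset.sum_div, le_div_iff₀ hpos] at h1
      have h2 := schattenOne_le_of_isSolution hX h1
      rw [mul_comm, ← le_div_iff₀ (by positivity)] at h2
      refine h2.trans (le_of_eq ?_)
      rw [hδ]
      field_simp
      ring

/-- The sampling condition absorbs the cardinality of the net into the exponent. -/
theorem two_mul_pow_mul_exp_le {K b : ℝ} (hK : 1 ≤ K) (hb0 : 0 < b) (hb1 : b ≤ 1)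
    (hmn : 200 * 2 ^ 60 * (K ^ 20 / b ^ 10) * n ≤ m) :
    2 * 25 ^ n * Real.exp (-(m * (b ^ 10 / (25 * 2 ^ 60 * K ^ 10)))) ≤
      2 * Real.exp (-(m * b ^ 16) / (50 * 2 ^ 60 * K ^ 16)) := by
  have hK0 : 0 < K := by linarith
  have h25 : (25 : ℝ) ^ n ≤ Real.exp (4 * n) := by
    rw [mul_comm, Real.exp_nat_mul]
    refine pow_le_pow_left₀ (by norm_num) ?_ n
    have h1 : Real.exp 4 = Real.exp 1 ^ 4 := by rw [← Real.exp_nat_mul]; norm_num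
    rw [h1]
    have h2 := Real.exp_one_gt_d9
    calc (25 : ℝ) ≤ 2.7 ^ 4 := by norm_num
      _ ≤ Real.exp 1 ^ 4 := pow_le_pow_left₀ (by norm_num) (by linarith) 4
  set q := m * (b ^ 10 / (50 * 2 ^ 60 * K ^ 10)) with hq
  have hn4 : 4 * (n : ℝ) ≤ q := by
    rw [hq, ← mul_div_assoc, le_div_iff₀ (by positivity)]
    have h1 : 200 * 2 ^ 60 * K ^ 20 * n ≤ m * b ^ 10 := by
      have := mul_le_mul_of_nonneg_right hmn (pow_pos hb0 10).le
      refine le_trans (le_of_eq ?_) this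
      field_simp
    have h2 : K ^ 10 ≤ K ^ 20 := pow_le_pow_right₀ hK (by norm_num)
    have h3 := mul_le_mul_of_nonneg_right h2 (Nat.cast_nonneg (α := ℝ) n)
    nlinarith
  have hq2 : m * b ^ 16 / (50 * 2 ^ 60 * K ^ 16) ≤ q := by
    rw [hq, ← mul_div_assoc]
    have h1 : b ^ 16 ≤ b ^ 10 := pow_le_pow_of_le_one hb0.le hb1 (by norm_num)
    have h2 : K ^ 10 ≤ K ^ 16 := pow_le_pow_right₀ hK (by norm_num)
    gcongr
  have hq1 : m * (b ^ 10 / (25 * 2 ^ 60 * K ^ 10)) = 2 * q := by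
    rw [hq]
    field_simp
    ring
  rw [hq1, mul_assoc]
  refine mul_le_mul_of_nonneg_left ?_ zero_le_two
  refine (mul_le_mul_of_nonneg_right h25 (Real.exp_pos _).le).trans ?_
  rw [← Real.exp_add, neg_div]
  apply Real.exp_le_exp.2
  linarith

end Recovery

end PhaseLift

theorem theorem3p1 :
    ∃ C₁ C₂ C₃ C₄ : ℝ, 0 < C₁ ∧ 0 < C₂ ∧ 0 < C₃ ∧ 0 < C₄ ∧
      ∀ (Ω : Type*) [MeasurableSpace Ω] (P : Measure Ω) [IsProbabilityMeasure P]
        (n m : ℕ) (ξ : Fin m → Ω → EuclideanSpace ℂ (Fin n)) (K β : ℝ),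
        PhaseLift.IsSubgaussianEnsemble P ξ K →
        0 < β → β < 1 →
        (∀ i j, ‖∫ ω, (ξ i ω j) ^ 2 ∂P‖ ^ 2 ≤ 1 - β) →
        C₁ * (K ^ 20 / β ^ (5 / 2 : ℝ)) * n ≤ m →
        (∃ E : Set Ω, MeasurableSet E ∧
          1 - C₄ * Real.exp (-(m * β ^ 4) / (C₂ * K ^ 16)) ≤ P.real E ∧
          ∀ ω ∈ E, PhaseLift.UniformRecovery (fun i => ξ i ω)
            (PhaseLift.boundedPeakSignals n (1 / 81))
            (C₃ * (K ^ 8 / (m * β ^ (5 / 2 : ℝ))))) ∧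
        ((∀ i j, 1 + β ≤ ∫ ω, ‖ξ i ω j‖ ^ 4 ∂P) →
          ∃ E : Set Ω, MeasurableSet E ∧
            1 - C₄ * Real.exp (-(m * β ^ 4) / (C₂ * K ^ 16)) ≤ P.real E ∧
            ∀ ω ∈ E, PhaseLift.UniformRecovery (fun i => ξ i ω)
              {x₀ | x₀ ≠ 0}
              (C₃ * (K ^ 8 / (m * β ^ (5 / 2 : ℝ))))) := by
  refine ⟨200 * 2 ^ 60, 50 * 2 ^ 60, 1310720, 2, by positivity, by positivity, by positivity,
    by positivity, ?_⟩
  intro Ω _ P _ n m ξ K β h hβ0 hβ1 hσ hmn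
  -- Without signals the claim is void, and without observations the probability bound is.
  have key : ∀ S : Set (EuclideanSpace ℂ (Fin n)), (0 ∉ S) →
      (∀ _ : 0 < n, ∀ x₀ ∈ S, ∀ X ∈ PhaseLift.psdCone n, ∀ i,
        β / 20 * PhaseLift.schattenOne (X - PhaseLift.rankOne x₀) ^ 2 ≤
          ∫ ω, PhaseLift.hsInner (PhaseLift.rankOne (ξ i ω)) (X - PhaseLift.rankOne x₀) ^ 2 ∂P) →
      ∃ E : Set Ω, MeasurableSet E ∧
        1 - 2 * Real.exp (-(m * β ^ 4) / (50 * 2 ^ 60 * K ^ 16)) ≤ P.real E ∧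
        ∀ ω ∈ E, PhaseLift.UniformRecovery (fun i => ξ i ω) S
          (1310720 * (K ^ 8 / (m * β ^ (5 / 2 : ℝ)))) := by
    intro S hS0 hS
    rcases Nat.eq_zero_or_pos n with rfl | hn
    · refine ⟨Set.univ, MeasurableSet.univ, ?_, fun ω _ x₀ hx₀ => ?_⟩
      · rw [probReal_univ]
        linarith [Real.exp_pos (-(m * β ^ 4) / (50 * 2 ^ 60 * K ^ 16))]
      · exact absurd (Subsingleton.elim x₀ 0 ▸ hx₀) hS0
    rcases Nat.eq_zero_or_pos m with rfl | hm
    · refine ⟨∅, MeasurableSet.empty, ?_, fun ω hω => absurd hω (Set.notMem_empty ω)⟩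
      norm_num
    set b : ℝ := β ^ (1 / 4 : ℝ) with hb
    have hb0 : 0 < b := Real.rpow_pos_of_pos hβ0 _
    have hb1 : b ≤ 1 := Real.rpow_le_one hβ0.le hβ1.le (by norm_num)
    have hb4 : b ^ 4 = β := by
      rw [hb, ← Real.rpow_mul_natCast hβ0.le]; norm_num
    have hb10 : b ^ 10 = β ^ (5 / 2 : ℝ) := by
      rw [hb, ← Real.rpow_mul_natCast hβ0.le]; norm_num
    have hb16 : b ^ 16 = β ^ 4 := by rw [← hb4]; ring
    have hK : 1 ≤ K := h.one_le ⟨0, hm⟩ ⟨0, hn⟩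
    have hm' : (0 : ℝ) < m := Nat.cast_pos.2 hm
    obtain ⟨E, hE, hPE, hgood⟩ := h.exists_uniformRecovery hn hm hb0 hb1 S (by
      rw [hb4]; exact hS hn)
    refine ⟨E, hE, ?_, fun ω hω => (hgood ω hω).mono ?_⟩
    · rw [← hb10] at hmn
      rw [← hb16]
      linarith [PhaseLift.two_mul_pow_mul_exp_le hK hb0 hb1 hmn]
    · rw [← hb10]
      have h1 : b ^ 10 ≤ b ^ 5 := pow_le_pow_of_le_one hb0.le hb1 (by norm_num)
      have h2 : K ^ 3 ≤ K ^ 8 := pow_le_pow_right₀ hK (by norm_num)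
      gcongr
  refine ⟨key _ (fun h0 => h0.1 rfl) fun hn x₀ hx₀ X hX i =>
      h.schattenOne_sq_le_integral_of_mem_boundedPeakSignals hβ0 hβ1 hσ hn hx₀ hX i,
    fun hκ => key _ (fun h0 => h0 rfl) fun hn x₀ hx₀ X hX i =>
      h.schattenOne_sq_le_integral_of_ne_zero hβ0 hβ1 hσ hκ hn hx₀ hX i⟩
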